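/- Let $n\ge 2$ and let $\sigma\in SL(n,\mathbb Z)$ be hyperbolic, i.e. no complex eigenvalue of $\sigma$ has absolute value $1$. Let $\hat\sigma$ be the automorphism of the lattice $\mathbb Z^n\cong\widehat{\mathbb T^n}$ that is Pontryagin dual to the automorphism of $\mathbb T^n=\mathbb R^n/\mathbb Z^n$ induced by $\sigma$ (that is, $\hat\sigma(m)=\sigma^{T}m$), and let $\Gamma=\mathbb Z^n\rtimes_{\hat\sigma}\mathbb Z$, where the generator of $\mathbb Z$ acts by $\hat\sigma$. Then the discrete group $\Gamma$ is torsion-free, non-abelian and amenable, and Type 2 (defined below) holds for the compact quantum group $H=C^*(\Gamma)$ with comultiplication $\Delta$ determined by $\Delta(\gamma)=\gamma\otimes\gamma$ for $\gamma\in\Gamma$. In particular, there is a torsion-free, non-abelian, amenable discrete group $\Gamma$ such that Type 2 holds for $C^*(\Gamma)$. Definitions. All tensor products of $C^*$-algebras are minimal. A coaction of a compact quantum group $(H,\Delta)$ on a unital $C^*$-algebra $A$ is an injective unital $*$-homomorphism $\delta:A\to A\otimes H$ such that $(\delta\otimes\mathrm{id})\delta=(\mathrm{id}\otimes\Delta)\delta$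 and the closed linear span of $\{\delta(a)(1\otimes h): a\in A,\ h\in H\}$ is $A\otimes H$. It is free if the closed linear span of $\{(a\otimes 1)\delta(b): a,b\in A\}$ is $A\otimes H$. The equivariant join is $$A\circledast_\delta H=\{f\in C([0,1],A\otimes H) : f(0)\in\mathbb C\otimes H,\ f(1)\in\delta(A)\},$$ with the coaction $\delta_\Delta$ of $(H,\Delta)$ that applies $\mathrm{id}\otimes\Delta$ at every point of $[0,1]$. Type 2 holds for $(H,\Delta)$ if for every non-zero unital $C^*$-algebra $A$ with a free coaction $\delta$ of $(H,\Delta)$ there is no unital $*$-homomorphism $\psi:H\to A\circledast_\delta H$ that is equivariant, i.e. satisfies $\delta_\Delta\circ\psi=(\psi\otimes\mathrm{id})\circ\Delta$. -/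

import Mathlib

open scoped TensorProduct InnerProductSpace

noncomputable section

set_option linter.unusedSectionVars false

/-! ### C*-seminorms and C*-completions of complex star-algebras -/

/-- A C*-seminorm on a unital complex star-algebra. -/
structure CStarSeminorm (R : Type*) [Ring R] [StarRing R] [Algebra ℂ R] extends
    Seminorm ℂ R where
  mul_le : ∀ x y : R, toFun (x * y) ≤ toFun x * toFun y
  star_mul_self : ∀ x : R, toFun (star x * x) = toFun x * toFun x

namespace CStarSeminorm

section Basic

variable {R : Type*} [Ring R] [StarRing R] [Algebra ℂ R]

instance : CoeFun (CStarSeminorm R) (fun _ => R → ℝ) := ⟨fun p => p.toSeminorm⟩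

theorem apply_nonneg (p : CStarSeminorm R) (x : R) : 0 ≤ p x :=
  NonnegHomClass.apply_nonneg p.toSeminorm x

theorem mul_apply_le (p : CStarSeminorm R) (x y : R) : p (x * y) ≤ p x * p y := p.mul_le x y

theorem star_mul_self_apply (p : CStarSeminorm R) (x : R) : p (star x * x) = p x * p x :=
  p.star_mul_self x

theorem apply_le_star (p : CStarSeminorm R) (x : R) : p x ≤ p (star x) := by
  rcases (p.apply_nonneg x).eq_or_lt with h | h
  · rw [← h]; exact p.apply_nonneg _
  · have h1 := p.star_mul_self_apply x
    have h2 := p.mul_apply_le (star x) x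
    rw [h1] at h2
    exact le_of_mul_le_mul_right h2 h

theorem star_apply (p : CStarSeminorm R) (x : R) : p (star x) = p x :=
  le_antisymm (by simpa using p.apply_le_star (star x)) (p.apply_le_star x)

theorem one_apply_le (p : CStarSeminorm R) : p 1 ≤ 1 := by
  have h := p.star_mul_self_apply 1
  simp only [star_one, mul_one] at h
  by_contra! hlt
  nlinarith

/-- The C*-seminorm `x ↦ ‖π x‖` attached to a star-homomorphism into a C*-algebra. -/
def ofHom {C : Type*} [CStarAlgebra C] (π : R →⋆ₐ[ℂ] C) : CStarSeminorm R where
  toSeminorm := Seminorm.of (fun x => ‖π x‖) (fun x y => by simpa using norm_add_le _ _)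
    (fun a x => by rw [map_smul, norm_smul])
  mul_le x y := by
    change ‖π (x * y)‖ ≤ ‖π x‖ * ‖π y‖
    rw [map_mul]; exact norm_mul_le _ _
  star_mul_self x := by
    change ‖π (star x * x)‖ = ‖π x‖ * ‖π x‖
    rw [map_mul, map_star]; exact CStarRing.norm_star_mul_self

theorem ofHom_apply {C : Type*} [CStarAlgebra C] (π : R →⋆ₐ[ℂ] C) (x : R) :
    ofHom π x = ‖π x‖ := rfl

/-- The pointwise supremum of a pointwise bounded set of C*-seminorms. -/
def sup (S : Set (CStarSeminorm R)) (hS : ∀ x, ∃ c : ℝ, ∀ p ∈ S, p x ≤ c) :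
    CStarSeminorm R :=
  have bdd : ∀ x, BddAbove (Set.range fun p : S => p.1 x) := fun x => by
    obtain ⟨c, hc⟩ := hS x
    exact ⟨c, by rintro _ ⟨p, rfl⟩; exact hc p.1 p.2⟩
  have nn : ∀ x, 0 ≤ ⨆ p : S, p.1 x := fun x => Real.iSup_nonneg fun p => p.1.apply_nonneg x
  have le : ∀ (x) (p : S), p.1 x ≤ ⨆ p : S, p.1 x := fun x p => le_ciSup (bdd x) p
  { toSeminorm := Seminorm.of (fun x => ⨆ p : S, p.1 x)
      (fun x y => Real.iSup_le (fun p => (map_add_le_add p.1.toSeminorm x y).trans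
        (add_le_add (le x p) (le y p))) (add_nonneg (nn x) (nn y)))
      (fun a x => by
        rw [Real.mul_iSup_of_nonneg (norm_nonneg a)]
        exact iSup_congr fun p => map_smul_eq_mul p.1.toSeminorm a x)
    mul_le := fun x y => Real.iSup_le (fun p => (p.1.mul_apply_le x y).trans
        (mul_le_mul (le x p) (le y p) (p.1.apply_nonneg _) (nn x))) (mul_nonneg (nn x) (nn y))
    star_mul_self := fun x => by
      change (⨆ p : S, p.1 (star x * x)) = (⨆ p : S, p.1 x) * (⨆ p : S, p.1 x)
      apply le_antisymm
      · refine Real.iSup_le (fun p => ?_) (mul_nonneg (nn x) (nn x))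
        rw [p.1.star_mul_self_apply]
        exact mul_le_mul (le x p) (le x p) (p.1.apply_nonneg _) (nn x)
      · have hM : ∀ p : S, p.1 (star x * x) ≤ ⨆ p : S, p.1 (star x * x) :=
          fun p => le (star x * x) p
        have h : (⨆ p : S, p.1 x) ≤ Real.sqrt (⨆ p : S, p.1 (star x * x)) := by
          refine Real.iSup_le (fun p => Real.le_sqrt_of_sq_le ?_) (Real.sqrt_nonneg _)
          rw [pow_two, ← p.1.star_mul_self_apply]
          exact hM p
        calc _ ≤ _ := mul_le_mul h h (nn x) (Real.sqrt_nonneg _)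
          _ = _ := Real.mul_self_sqrt (nn (star x * x)) }

theorem sup_apply (S : Set (CStarSeminorm R)) (hS : ∀ x, ∃ c : ℝ, ∀ p ∈ S, p x ≤ c) (x : R) :
    sup S hS x = ⨆ p : S, p.1 x := rfl

theorem le_sup (S : Set (CStarSeminorm R)) (hS : ∀ x, ∃ c : ℝ, ∀ p ∈ S, p x ≤ c)
    (p : CStarSeminorm R) (hp : p ∈ S) (x : R) : p x ≤ sup S hS x := by
  obtain ⟨c, hc⟩ := hS x
  exact le_ciSup (f := fun p : S => p.1 x) ⟨c, by rintro _ ⟨p, rfl⟩; exact hc p.1 p.2⟩ ⟨p, hp⟩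

theorem sup_le (S : Set (CStarSeminorm R)) (hS : ∀ x, ∃ c : ℝ, ∀ p ∈ S, p x ≤ c)
    (x : R) (c : ℝ) (h0 : 0 ≤ c) (h : ∀ p ∈ S, p x ≤ c) : sup S hS x ≤ c :=
  Real.iSup_le (fun p => h p.1 p.2) h0

/-- The star-algebra `R` regarded as a seminormed space through `p`. -/
def Carrier (_p : CStarSeminorm R) : Type _ := R

variable (p : CStarSeminorm R)

instance : Ring p.Carrier := inferInstanceAs (Ring R)

instance : SeminormedRing p.Carrier :=
  { (inferInstance : Ring p.Carrier),
    p.toSeminorm.toAddGroupSeminorm.toSeminormedAddCommGroup with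
    norm_mul_le := fun x y => p.mul_apply_le x y }

instance : StarRing p.Carrier := inferInstanceAs (StarRing R)
instance : Algebra ℂ p.Carrier := inferInstanceAs (Algebra ℂ R)

instance : NormedAlgebra ℂ p.Carrier where
  norm_smul_le a x := (map_smul_eq_mul p.toSeminorm a x).le

/-- The identity map from `R` to `p.Carrier`. -/
def toCarrier : R →+* p.Carrier := RingHom.id R

/-- The identity map from `p.Carrier` to `R`. -/
def ofCarrier : p.Carrier →+* R := RingHom.id R

theorem norm_carrier (x : p.Carrier) : ‖x‖ = p (p.ofCarrier x) := rfl

/-- The C*-completion of `R` with respect to the C*-seminorm `p` (the Hausdorff completion). -/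
def Completion : Type _ := UniformSpace.Completion p.Carrier

instance : NormedRing p.Completion := inferInstanceAs (NormedRing (UniformSpace.Completion p.Carrier))
instance : CompleteSpace p.Completion :=
  inferInstanceAs (CompleteSpace (UniformSpace.Completion p.Carrier))
instance : Algebra ℂ p.Completion :=
  inferInstanceAs (Algebra ℂ (UniformSpace.Completion p.Carrier))
instance : NormedAlgebra ℂ p.Completion where
  norm_smul_le a x := norm_smul_le (β := UniformSpace.Completion p.Carrier) a x

/-- The canonical map from `R` to its C*-completion. -/
def coe (x : R) : p.Completion :=
  UniformSpace.Completion.coe' (p.toCarrier x)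

theorem coe_add (x y : R) : p.coe (x + y) = p.coe x + p.coe y :=
  UniformSpace.Completion.coe_add (α := p.Carrier) x y
theorem coe_mul (x y : R) : p.coe (x * y) = p.coe x * p.coe y :=
  UniformSpace.Completion.coe_mul (α := p.Carrier) x y
theorem coe_one : p.coe 1 = 1 := rfl
theorem coe_algebraMap (c : ℂ) : p.coe (algebraMap ℂ R c) = algebraMap ℂ p.Completion c := rfl
theorem coe_smul (c : ℂ) (x : R) : p.coe (c • x) = c • p.coe x := by
  rw [Algebra.smul_def, Algebra.smul_def, coe_mul, coe_algebraMap]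
theorem norm_coe (x : R) : ‖p.coe x‖ = p x :=
  UniformSpace.Completion.norm_coe (p.toCarrier x)

theorem denseRange_coe : DenseRange p.coe :=
  UniformSpace.Completion.denseRange_coe (α := p.Carrier)

theorem induction {P : p.Completion → Prop} (hc : IsClosed {x | P x}) (h : ∀ x, P (p.coe x))
    (x : p.Completion) : P x :=
  UniformSpace.Completion.induction_on (α := p.Carrier) x hc h

theorem induction₂ {P : p.Completion → p.Completion → Prop}
    (hc : IsClosed {x : p.Completion × p.Completion | P x.1 x.2})
    (h : ∀ x y, P (p.coe x) (p.coe y)) (x y : p.Completion) : P x y :=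
  UniformSpace.Completion.induction_on₂ (α := p.Carrier) x y hc h

instance : Star p.Completion := ⟨UniformSpace.Completion.map (star : p.Carrier → p.Carrier)⟩

theorem uniformContinuous_star : UniformContinuous (star : p.Carrier → p.Carrier) := by
  apply LipschitzWith.uniformContinuous (K := 1)
  refine LipschitzWith.of_dist_le_mul fun x y => ?_
  rw [dist_eq_norm, dist_eq_norm, ← star_sub, NNReal.coe_one, one_mul]
  exact (p.star_apply (show R from x - y)).le

theorem coe_star (x : R) : p.coe (star x) = star (p.coe x) :=
  (UniformSpace.Completion.map_coe p.uniformContinuous_star x).symm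

instance : ContinuousStar p.Completion := ⟨UniformSpace.Completion.continuous_map⟩

variable [StarModule ℂ R]

instance : StarRing p.Completion where
  star_involutive := p.induction
    (isClosed_eq (continuous_star.comp continuous_star) continuous_id)
    fun x => by rw [← coe_star, ← coe_star, star_star]
  star_mul := p.induction₂ (isClosed_eq (continuous_star.comp continuous_mul)
    ((continuous_star.comp continuous_snd).mul (continuous_star.comp continuous_fst)))
    fun x y => by rw [← coe_mul, ← coe_star, ← coe_star, ← coe_star, star_mul, coe_mul]
  star_add := p.induction₂ (isClosed_eq (continuous_star.comp continuous_add)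
    ((continuous_star.comp continuous_fst).add (continuous_star.comp continuous_snd)))
    fun x y => by rw [← coe_add, ← coe_star, ← coe_star, ← coe_star, star_add, coe_add]

instance : StarModule ℂ p.Completion where
  star_smul c x := p.induction (P := fun x => star (c • x) = star c • star x)
    (isClosed_eq (continuous_star.comp (continuous_const_smul c))
      ((continuous_const_smul (star c)).comp continuous_star))
    (fun x => by rw [← coe_smul, ← coe_star, ← coe_star, star_smul, coe_smul]) x

instance : CStarAlgebra p.Completion where
  norm_mul_self_le := p.induction (isClosed_le (continuous_norm.mul continuous_norm)
    (continuous_norm.comp (continuous_star.mul continuous_id))) fun x => by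
    rw [← coe_star, ← coe_mul, norm_coe, norm_coe, star_mul_self_apply]

/-- The canonical star-homomorphism from `R` to its C*-completion. -/
def of : R →⋆ₐ[ℂ] p.Completion where
  toFun := p.coe
  map_one' := rfl
  map_mul' := p.coe_mul
  map_zero' := rfl
  map_add' := p.coe_add
  commutes' _ := rfl
  map_star' := p.coe_star

theorem norm_of (x : R) : ‖p.of x‖ = p x := p.norm_coe x

theorem denseRange_of : DenseRange p.of := p.denseRange_coe

variable {p}

theorem hom_ext {C : Type*} [CStarAlgebra C] {f g : p.Completion →⋆ₐ[ℂ] C}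
    (h : ∀ x, f (p.of x) = g (p.of x)) : f = g := by
  refine DFunLike.ext _ _ (p.induction (isClosed_eq ?_ ?_) h)
  · exact (AddMonoidHomClass.continuous_of_bound f 1 fun x => by
      rw [one_mul]; exact NonUnitalStarAlgHom.norm_apply_le f x)
  · exact (AddMonoidHomClass.continuous_of_bound g 1 fun x => by
      rw [one_mul]; exact NonUnitalStarAlgHom.norm_apply_le g x)

theorem continuous_comp_ofCarrier {C : Type*} [CStarAlgebra C] (f : R →⋆ₐ[ℂ] C)
    (hf : ∀ x, ‖f x‖ ≤ p x) : Continuous ((f : R →+* C).comp p.ofCarrier) := by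
  refine AddMonoidHomClass.continuous_of_bound ((f : R →+* C).comp p.ofCarrier) 1 fun x => ?_
  rw [one_mul]; exact hf x

/-- A star-homomorphism from `R` into a C*-algebra that is dominated by `p` extends uniquely to
the C*-completion. -/
def lift {C : Type*} [CStarAlgebra C] (f : R →⋆ₐ[ℂ] C) (hf : ∀ x, ‖f x‖ ≤ p x) :
    p.Completion →⋆ₐ[ℂ] C :=
  have hc := continuous_comp_ofCarrier f hf
  let F : p.Completion →+* C :=
    UniformSpace.Completion.extensionHom ((f : R →+* C).comp p.ofCarrier) hc
  have hF : ∀ x, F (p.coe x) = f x := fun x =>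
    UniformSpace.Completion.extensionHom_coe ((f : R →+* C).comp p.ofCarrier) hc x
  have hFc : Continuous F := UniformSpace.Completion.continuous_extension
  { F with
    commutes' := fun c => (hF _).trans (f.commutes' c)
    map_star' := p.induction (isClosed_eq (hFc.comp continuous_star) (continuous_star.comp hFc))
      fun x => by
        change F (star (p.coe x)) = star (F (p.coe x))
        rw [← coe_star, hF, hF, map_star] }

@[simp] theorem lift_of {C : Type*} [CStarAlgebra C] (f : R →⋆ₐ[ℂ] C) (hf : ∀ x, ‖f x‖ ≤ p x)
    (x : R) : lift f hf (p.of x) = f x := by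
  have hc := continuous_comp_ofCarrier f hf
  exact UniformSpace.Completion.extensionHom_coe ((f : R →+* C).comp p.ofCarrier) hc x

end Basic

end CStarSeminorm

/-! ### Hilbert space tensor products -/

section HilbertTensor

variable {H H' H'' K K' K'' L : Type*}
  [NormedAddCommGroup H] [InnerProductSpace ℂ H] [CompleteSpace H]
  [NormedAddCommGroup H'] [InnerProductSpace ℂ H'] [CompleteSpace H']
  [NormedAddCommGroup H''] [InnerProductSpace ℂ H''] [CompleteSpace H'']
  [NormedAddCommGroup K] [InnerProductSpace ℂ K] [CompleteSpace K]
  [NormedAddCommGroup K'] [InnerProductSpace ℂ K'] [CompleteSpace K']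
  [NormedAddCommGroup K''] [InnerProductSpace ℂ K''] [CompleteSpace K'']
  [NormedAddCommGroup L] [InnerProductSpace ℂ L] [CompleteSpace L]

/-- The Hilbert space tensor product of two Hilbert spaces: the completion of the algebraic tensor
product for the inner product `⟪x ⊗ y, x' ⊗ y'⟫ = ⟪x, x'⟫ ⟪y, y'⟫`. -/
def HilbertTensor (H K : Type*) [NormedAddCommGroup H] [InnerProductSpace ℂ H]
    [NormedAddCommGroup K] [InnerProductSpace ℂ K] : Type _ :=
  UniformSpace.Completion (H ⊗[ℂ] K)

namespace HilbertTensor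

instance : NormedAddCommGroup (HilbertTensor H K) :=
  inferInstanceAs (NormedAddCommGroup (UniformSpace.Completion (H ⊗[ℂ] K)))
instance : InnerProductSpace ℂ (HilbertTensor H K) :=
  inferInstanceAs (InnerProductSpace ℂ (UniformSpace.Completion (H ⊗[ℂ] K)))
instance : CompleteSpace (HilbertTensor H K) :=
  inferInstanceAs (CompleteSpace (UniformSpace.Completion (H ⊗[ℂ] K)))

/-- The canonical isometry of the algebraic tensor product into the Hilbert tensor product. -/
def coeL (H K : Type*) [NormedAddCommGroup H] [InnerProductSpace ℂ H]
    [NormedAddCommGroup K] [InnerProductSpace ℂ K] : H ⊗[ℂ] K →ₗᵢ[ℂ] HilbertTensor H K :=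
  (UniformSpace.Completion.toComplₗᵢ : H ⊗[ℂ] K →ₗᵢ[ℂ] UniformSpace.Completion (H ⊗[ℂ] K))

theorem denseRange_coeL : DenseRange (coeL H K) :=
  UniformSpace.Completion.denseRange_coe (α := H ⊗[ℂ] K)

theorem induction {P : HilbertTensor H K → Prop} (hc : IsClosed {x | P x})
    (h : ∀ x, P (coeL H K x)) (x : HilbertTensor H K) : P x :=
  UniformSpace.Completion.induction_on (α := H ⊗[ℂ] K) x hc h

theorem induction₂ {P : HilbertTensor H K → HilbertTensor H K → Prop}
    (hc : IsClosed {x : HilbertTensor H K × HilbertTensor H K | P x.1 x.2})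
    (h : ∀ x y, P (coeL H K x) (coeL H K y)) (x y : HilbertTensor H K) : P x y :=
  UniformSpace.Completion.induction_on₂ (α := H ⊗[ℂ] K) x y hc h

/-- Extension of a bounded linear map from the algebraic to the Hilbert tensor product. -/
def extend {E : Type*} [NormedAddCommGroup E] [NormedSpace ℂ E] [CompleteSpace E]
    (f : H ⊗[ℂ] K →ₗ[ℂ] E) (c : ℝ) (hf : ∀ ξ, ‖f ξ‖ ≤ c * ‖ξ‖) : HilbertTensor H K →L[ℂ] E :=
  (f.mkContinuous c hf).fromCompletion

theorem extend_coeL {E : Type*} [NormedAddCommGroup E] [NormedSpace ℂ E] [CompleteSpace E]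
    (f : H ⊗[ℂ] K →ₗ[ℂ] E) (c : ℝ) (hf : ∀ ξ, ‖f ξ‖ ≤ c * ‖ξ‖) (ξ : H ⊗[ℂ] K) :
    extend f c hf (coeL H K ξ) = f ξ :=
  ContinuousLinearMap.fromCompletion_apply_coe (f.mkContinuous c hf) ξ

/-- The elementary tensor `x ⊗ y`. -/
def tmul (x : H) (y : K) : HilbertTensor H K := coeL H K (x ⊗ₜ[ℂ] y)

open ContinuousLinearMap

theorem inner_map (T : H →L[ℂ] H') (S : K →L[ℂ] K') (ξ : H ⊗[ℂ] K) (η : H' ⊗[ℂ] K') :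
    ⟪TensorProduct.map T.toLinearMap S.toLinearMap ξ, η⟫_ℂ =
      ⟪ξ, TensorProduct.map (adjoint T).toLinearMap (adjoint S).toLinearMap η⟫_ℂ := by
  induction ξ with
  | zero => simp
  | add a b ha hb => rw [map_add, inner_add_left, inner_add_left, ha, hb]
  | tmul x y =>
    induction η with
    | zero => simp
    | add a b ha hb => rw [map_add, inner_add_right, inner_add_right, ha, hb]
    | tmul x' y' => simp [TensorProduct.inner_tmul, adjoint_inner_right]

theorem inner_self_c {E : Type*} [NormedAddCommGroup E] [InnerProductSpace ℂ E] (x : E) :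
    ⟪x, x⟫_ℂ = ((‖x‖ ^ 2 : ℝ) : ℂ) := by
  rw [Complex.ofReal_pow]
  exact inner_self_eq_norm_sq_to_K (𝕜 := ℂ) x

theorem inner_self_eq (ξ : H ⊗[ℂ] K) : ⟪ξ, ξ⟫_ℂ = ((‖ξ‖ ^ 2 : ℝ) : ℂ) :=
  inner_self_c ξ

theorem exists_defect (T : H →L[ℂ] H') : ∃ b : H →L[ℂ] H,
    adjoint b ∘L b + adjoint T ∘L T = ((‖T‖ ^ 2 : ℝ) : ℂ) • ContinuousLinearMap.id ℂ H := by
  have h : (0 : H →L[ℂ] H) ≤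
      ((‖T‖ ^ 2 : ℝ) : ℂ) • ContinuousLinearMap.id ℂ H - adjoint T ∘L T := by
    rw [nonneg_iff_isPositive, isPositive_iff_complex]
    intro x
    have hx : ⟪(((‖T‖ ^ 2 : ℝ) : ℂ) • ContinuousLinearMap.id ℂ H - adjoint T ∘L T) x, x⟫_ℂ =
        ((‖T‖ ^ 2 * ‖x‖ ^ 2 - ‖T x‖ ^ 2 : ℝ) : ℂ) := by
      rw [sub_apply, inner_sub_left, comp_apply, adjoint_inner_left, inner_self_c,
        smul_apply, inner_smul_left, id_apply, inner_self_c, Complex.conj_ofReal,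
        Complex.ofReal_sub, Complex.ofReal_mul]
    rw [hx]
    refine ⟨by rw [RCLike.re_eq_complex_re, Complex.ofReal_re], ?_⟩
    rw [RCLike.re_eq_complex_re, Complex.ofReal_re, sub_nonneg, ← mul_pow]
    exact pow_le_pow_left₀ (norm_nonneg _) (T.le_opNorm x) 2
  obtain ⟨b, hb⟩ := CStarAlgebra.nonneg_iff_eq_star_mul_self.mp h
  refine ⟨b, ?_⟩
  have : adjoint b ∘L b = ((‖T‖ ^ 2 : ℝ) : ℂ) • ContinuousLinearMap.id ℂ H - adjoint T ∘L T :=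
    hb.symm
  rw [this, sub_add_cancel]

theorem norm_map_id_sq (T : H →L[ℂ] H') (ξ : H ⊗[ℂ] K) :
    ((‖TensorProduct.map T.toLinearMap (ContinuousLinearMap.id ℂ K).toLinearMap ξ‖ ^ 2 : ℝ) : ℂ) =
      ⟪ξ, TensorProduct.map (adjoint T ∘L T).toLinearMap
        (ContinuousLinearMap.id ℂ K).toLinearMap ξ⟫_ℂ := by
  have h := inner_map T (ContinuousLinearMap.id ℂ K) ξ
    (TensorProduct.map T.toLinearMap (ContinuousLinearMap.id ℂ K).toLinearMap ξ)
  rw [← inner_self_eq]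
  refine h.trans ?_
  rw [← LinearMap.comp_apply, ← TensorProduct.map_comp]
  congr 3
  ext y
  exact congrArg (fun F : K →L[ℂ] K => F y) (star_one (K →L[ℂ] K))

theorem norm_map_id_le (T : H →L[ℂ] H') (ξ : H ⊗[ℂ] K) :
    ‖TensorProduct.map T.toLinearMap (ContinuousLinearMap.id ℂ K).toLinearMap ξ‖ ≤
      ‖T‖ * ‖ξ‖ := by
  obtain ⟨b, hb⟩ := exists_defect T
  have h1 := norm_map_id_sq (K := K) b ξ
  have h2 := norm_map_id_sq (K := K) T ξ
  have h3 : (((‖TensorProduct.map b.toLinearMap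
      (ContinuousLinearMap.id ℂ K).toLinearMap ξ‖ ^ 2 +
      ‖TensorProduct.map T.toLinearMap
      (ContinuousLinearMap.id ℂ K).toLinearMap ξ‖ ^ 2 : ℝ)) : ℂ) =
      ((‖T‖ ^ 2 * ‖ξ‖ ^ 2 : ℝ) : ℂ) := by
    rw [Complex.ofReal_add, h1, h2]
    refine (inner_add_right (𝕜 := ℂ) ξ _ _).symm.trans ?_
    rw [← LinearMap.add_apply,
      ← TensorProduct.map_add_left, ← toLinearMap_add, hb, toLinearMap_smul,
      TensorProduct.map_smul_left, coe_id, coe_id, TensorProduct.map_id, LinearMap.smul_apply,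
      LinearMap.id_apply]
    refine (inner_smul_right (𝕜 := ℂ) ξ ξ _).trans ?_
    rw [Complex.ofReal_mul]
    exact congrArg _ (inner_self_eq ξ)
  have h4 := Complex.ofReal_injective h3
  refine le_of_sq_le_sq ?_ (by positivity)
  rw [mul_pow, ← h4]
  exact le_add_of_nonneg_left (by positivity)

theorem norm_map_le (T : H →L[ℂ] H') (S : K →L[ℂ] K') (ξ : H ⊗[ℂ] K) :
    ‖TensorProduct.map T.toLinearMap S.toLinearMap ξ‖ ≤ (‖T‖ * ‖S‖) * ‖ξ‖ := by
  have h1 : TensorProduct.map T.toLinearMap S.toLinearMap ξ =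
      TensorProduct.map T.toLinearMap (ContinuousLinearMap.id ℂ K').toLinearMap
        (TensorProduct.comm ℂ K' H (TensorProduct.map S.toLinearMap
          (ContinuousLinearMap.id ℂ H).toLinearMap (TensorProduct.comm ℂ H K ξ))) := by
    induction ξ with
    | zero => simp
    | add a b ha hb => simp only [map_add, ha, hb]
    | tmul x y => simp
  rw [h1, mul_assoc]
  refine (norm_map_id_le _ _).trans (mul_le_mul_of_nonneg_left ?_ (norm_nonneg _))
  rw [TensorProduct.norm_comm]
  refine (norm_map_id_le _ _).trans_eq ?_
  rw [TensorProduct.norm_comm]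

/-- The bounded operator `T ⊗ S` between Hilbert space tensor products. -/
def mapL (T : H →L[ℂ] H') (S : K →L[ℂ] K') : HilbertTensor H K →L[ℂ] HilbertTensor H' K' :=
  extend ((coeL H' K').toLinearMap ∘ₗ TensorProduct.map T.toLinearMap S.toLinearMap)
    (‖T‖ * ‖S‖) fun ξ => ((coeL H' K').norm_map _).trans_le (norm_map_le T S ξ)

theorem mapL_coeL (T : H →L[ℂ] H') (S : K →L[ℂ] K') (ξ : H ⊗[ℂ] K) :
    mapL T S (coeL H K ξ) = coeL H' K' (TensorProduct.map T.toLinearMap S.toLinearMap ξ) :=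
  extend_coeL _ _ _ ξ

@[simp] theorem mapL_tmul (T : H →L[ℂ] H') (S : K →L[ℂ] K') (x : H) (y : K) :
    mapL T S (tmul x y) = tmul (T x) (S y) :=
  mapL_coeL T S (x ⊗ₜ y)

theorem inner_coeL (ξ η : H ⊗[ℂ] K) : ⟪coeL H K ξ, coeL H K η⟫_ℂ = ⟪ξ, η⟫_ℂ :=
  (coeL H K).inner_map_map ξ η

theorem inner_tmul (x x' : H) (y y' : K) :
    ⟪tmul x y, tmul x' y'⟫_ℂ = ⟪x, x'⟫_ℂ * ⟪y, y'⟫_ℂ :=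
  (inner_coeL _ _).trans (TensorProduct.inner_tmul _ _ _ _ _)

theorem ext {E : Type*} [NormedAddCommGroup E] [NormedSpace ℂ E]
    {F G : HilbertTensor H K →L[ℂ] E} (h : ∀ x y, F (tmul x y) = G (tmul x y)) : F = G := by
  refine ContinuousLinearMap.ext (induction (isClosed_eq F.continuous G.continuous) fun ξ => ?_)
  induction ξ with
  | zero => rw [map_zero, map_zero, map_zero]
  | add a b ha hb => rw [map_add, map_add, map_add, ha, hb]
  | tmul x y => exact h x y

theorem tmul_add (x : H) (y y' : K) : tmul x (y + y') = tmul x y + tmul x y' := by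
  rw [tmul, TensorProduct.tmul_add, map_add]; rfl

theorem add_tmul (x x' : H) (y : K) : tmul (x + x') y = tmul x y + tmul x' y := by
  rw [tmul, TensorProduct.add_tmul, map_add]; rfl

theorem tmul_smul (c : ℂ) (x : H) (y : K) : tmul x (c • y) = c • tmul x y := by
  rw [tmul, TensorProduct.tmul_smul, map_smul]; rfl

theorem smul_tmul (c : ℂ) (x : H) (y : K) : tmul (c • x) y = c • tmul x y := by
  rw [tmul, ← TensorProduct.smul_tmul', map_smul]; rfl

theorem zero_tmul (y : K) : tmul (0 : H) y = 0 := by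
  rw [tmul, TensorProduct.zero_tmul, map_zero]

theorem tmul_zero (x : H) : tmul x (0 : K) = 0 := by
  rw [tmul, TensorProduct.tmul_zero, map_zero]

theorem mapL_mul (T T' : H →L[ℂ] H) (S S' : K →L[ℂ] K) :
    mapL (T * T') (S * S') = mapL T S * mapL T' S' := ext fun x y => by
  change _ = mapL T S (mapL T' S' (tmul x y))
  rw [mapL_tmul, mapL_tmul, mapL_tmul]; rfl

theorem mapL_one : mapL (1 : H →L[ℂ] H) (1 : K →L[ℂ] K) = 1 := ext fun x y => by
  rw [mapL_tmul]; rfl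

theorem star_mapL (T : H →L[ℂ] H) (S : K →L[ℂ] K) :
    star (mapL T S) = mapL (star T) (star S) := by
  refine ((eq_adjoint_iff (mapL (star T) (star S)) (mapL T S)).mpr fun ξ η => ?_).symm
  revert ξ η
  refine induction₂ (isClosed_eq (((mapL (star T) (star S)).continuous.comp continuous_fst).inner
    continuous_snd) (continuous_fst.inner ((mapL T S).continuous.comp continuous_snd)))
    fun ξ η => ?_
  have h := inner_map (adjoint T) (adjoint S) ξ η
  rw [adjoint_adjoint, adjoint_adjoint] at h
  rw [mapL_coeL, mapL_coeL, inner_coeL, inner_coeL]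
  exact h

/-- The star-homomorphism `T ↦ T ⊗ 1`. -/
def leftHom (H K : Type*) [NormedAddCommGroup H] [InnerProductSpace ℂ H] [CompleteSpace H]
    [NormedAddCommGroup K] [InnerProductSpace ℂ K] [CompleteSpace K] :
    (H →L[ℂ] H) →⋆ₐ[ℂ] (HilbertTensor H K →L[ℂ] HilbertTensor H K) where
  toFun T := mapL T 1
  map_one' := mapL_one
  map_mul' T T' := by rw [← mapL_mul, mul_one]
  map_zero' := ext fun x y => by
    rw [mapL_tmul, zero_apply, zero_apply, zero_tmul]
  map_add' T T' := ext fun x y => by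
    rw [mapL_tmul, add_apply, add_apply, mapL_tmul, mapL_tmul, add_tmul]
  commutes' c := ext fun x y => by
    rw [mapL_tmul, Algebra.algebraMap_eq_smul_one, Algebra.algebraMap_eq_smul_one, smul_apply,
      smul_apply, smul_tmul]; rfl
  map_star' T := by rw [star_mapL, star_one]

/-- The star-homomorphism `S ↦ 1 ⊗ S`. -/
def rightHom (H K : Type*) [NormedAddCommGroup H] [InnerProductSpace ℂ H] [CompleteSpace H]
    [NormedAddCommGroup K] [InnerProductSpace ℂ K] [CompleteSpace K] :
    (K →L[ℂ] K) →⋆ₐ[ℂ] (HilbertTensor H K →L[ℂ] HilbertTensor H K) where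
  toFun S := mapL 1 S
  map_one' := mapL_one
  map_mul' T T' := by rw [← mapL_mul, mul_one]
  map_zero' := ext fun x y => by
    rw [mapL_tmul, zero_apply, zero_apply, tmul_zero]
  map_add' T T' := ext fun x y => by
    rw [mapL_tmul, add_apply, add_apply, mapL_tmul, mapL_tmul, tmul_add]
  commutes' c := ext fun x y => by
    rw [mapL_tmul, Algebra.algebraMap_eq_smul_one, Algebra.algebraMap_eq_smul_one, smul_apply,
      smul_apply, tmul_smul]; rfl
  map_star' T := by rw [star_mapL, star_one]

theorem leftHom_mul_rightHom (T : H →L[ℂ] H) (S : K →L[ℂ] K) :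
    leftHom H K T * rightHom H K S = mapL T S := by
  change mapL T 1 * mapL 1 S = mapL T S
  rw [← mapL_mul, mul_one, one_mul]

theorem commute_left_right (T : H →L[ℂ] H) (S : K →L[ℂ] K) :
    Commute (leftHom H K T) (rightHom H K S) := by
  change mapL T 1 * mapL 1 S = mapL 1 S * mapL T 1
  rw [← mapL_mul, ← mapL_mul, mul_one, one_mul, mul_one, one_mul]

/-- The bounded operator `y ↦ x ⊗ y`. -/
def create (K : Type*) [NormedAddCommGroup K] [InnerProductSpace ℂ K] [CompleteSpace K] (x : H) :
    K →L[ℂ] HilbertTensor H K :=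
  LinearMap.mkContinuous
    { toFun := fun y => tmul x y
      map_add' := tmul_add x
      map_smul' := fun c y => tmul_smul c x y } ‖x‖ fun y => by
    change ‖coeL H K (x ⊗ₜ y)‖ ≤ _
    rw [(coeL H K).norm_map, TensorProduct.norm_tmul]

@[simp] theorem create_apply (x : H) (y : K) : create K x y = tmul x y := rfl

theorem inner_mapL_create (x x' : H) (w w' : HilbertTensor K L) :
    ⟪mapL (create K x) (1 : L →L[ℂ] L) w, mapL (create K x') (1 : L →L[ℂ] L) w'⟫_ℂ =
      ⟪x, x'⟫_ℂ * ⟪w, w'⟫_ℂ := by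
  have h1 : ((adjoint (mapL (create K x) (1 : L →L[ℂ] L))) ∘L
      mapL (create K x') (1 : L →L[ℂ] L)) = ⟪x, x'⟫_ℂ • ContinuousLinearMap.id ℂ _ := by
    refine ext fun y v => ?_
    refine ext_inner_left ℂ fun u => ?_
    have h2 : (innerSL ℂ (⟪x, x'⟫_ℂ • tmul y v)) =
        (innerSL ℂ (mapL (create K x') (1 : L →L[ℂ] L) (tmul y v))) ∘L
          mapL (create K x) (1 : L →L[ℂ] L) := by
      refine ext fun y' v' => ?_
      simp only [innerSL_apply_apply, comp_apply, mapL_tmul, create_apply, inner_tmul,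
        inner_smul_left, inner_conj_symm]
      exact (mul_assoc _ _ _).symm
    have h3 := congrArg (fun F => (starRingEnd ℂ) (F u)) h2
    simp only [innerSL_apply_apply, comp_apply, inner_conj_symm] at h3
    rw [comp_apply, adjoint_inner_right, ← h3]; rfl
  have h2 := congrArg (fun F => ⟪w, F w'⟫_ℂ) h1
  simpa [adjoint_inner_right, inner_smul_right] using h2

/-- The algebraic form of the canonical isometry `H ⊗ (K ⊗ L) → (H ⊗ K) ⊗ L`. -/
def assocAlg (H K L : Type*)
    [NormedAddCommGroup H] [InnerProductSpace ℂ H] [CompleteSpace H]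
    [NormedAddCommGroup K] [InnerProductSpace ℂ K] [CompleteSpace K]
    [NormedAddCommGroup L] [InnerProductSpace ℂ L] [CompleteSpace L] :
    H ⊗[ℂ] HilbertTensor K L →ₗ[ℂ] HilbertTensor (HilbertTensor H K) L :=
  TensorProduct.lift (LinearMap.mk₂ ℂ
    (fun x w => mapL (create K x) (1 : L →L[ℂ] L) w)
    (fun x x' w => by
      have : mapL (create K (x + x')) (1 : L →L[ℂ] L) =
          mapL (create K x) 1 + mapL (create K x') 1 := ext fun y v => by
        simp [add_tmul]
      rw [this, add_apply])
    (fun c x w => by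
      have : mapL (create K (c • x)) (1 : L →L[ℂ] L) = c • mapL (create K x) 1 :=
        ext fun y v => by simp [smul_tmul]
      rw [this, smul_apply])
    (fun x w w' => map_add _ w w')
    (fun c x w => map_smul _ c w))

theorem norm_eq_of_inner (f : H ⊗[ℂ] K →ₗ[ℂ] L)
    (hf : ∀ x y x' y', ⟪f (x ⊗ₜ y), f (x' ⊗ₜ y')⟫_ℂ = ⟪x, x'⟫_ℂ * ⟪y, y'⟫_ℂ)
    (ξ : H ⊗[ℂ] K) : ‖f ξ‖ = ‖ξ‖ := by
  have h : ∀ ξ η, ⟪f ξ, f η⟫_ℂ = ⟪ξ, η⟫_ℂ := fun ξ η => by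
    induction ξ with
    | zero => rw [map_zero, inner_zero_left]; exact (inner_zero_left (𝕜 := ℂ) η).symm
    | add a b ha hb =>
      rw [map_add, inner_add_left, ha, hb]; exact (inner_add_left (𝕜 := ℂ) a b η).symm
    | tmul x w =>
      induction η with
      | zero => rw [map_zero, inner_zero_right]; exact (inner_zero_right (𝕜 := ℂ) (x ⊗ₜ w)).symm
      | add a b ha hb =>
        rw [map_add, inner_add_right, ha, hb]
        exact (inner_add_right (𝕜 := ℂ) (x ⊗ₜ w) a b).symm
      | tmul x' w' => rw [TensorProduct.inner_tmul, hf]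
  have h1 := h ξ ξ
  rw [inner_self_c, inner_self_eq] at h1
  exact (sq_eq_sq₀ (norm_nonneg _) (norm_nonneg _)).mp (Complex.ofReal_injective h1)

theorem norm_assocAlg (ξ : H ⊗[ℂ] HilbertTensor K L) : ‖assocAlg H K L ξ‖ = ‖ξ‖ :=
  norm_eq_of_inner (assocAlg H K L) (fun x w x' w' => inner_mapL_create x x' w w') ξ

/-- The canonical isometry `H ⊗ (K ⊗ L) → (H ⊗ K) ⊗ L`. -/
def assoc (H K L : Type*)
    [NormedAddCommGroup H] [InnerProductSpace ℂ H] [CompleteSpace H]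
    [NormedAddCommGroup K] [InnerProductSpace ℂ K] [CompleteSpace K]
    [NormedAddCommGroup L] [InnerProductSpace ℂ L] [CompleteSpace L] :
    HilbertTensor H (HilbertTensor K L) →L[ℂ] HilbertTensor (HilbertTensor H K) L :=
  extend (assocAlg H K L) 1 fun ξ => by rw [norm_assocAlg, one_mul]

@[simp] theorem assoc_tmul (x : H) (y : K) (v : L) :
    assoc H K L (tmul x (tmul y v)) = tmul (tmul x y) v := by
  have : assoc H K L (tmul x (tmul y v)) = mapL (create K x) (1 : L →L[ℂ] L) (tmul y v) :=
    extend_coeL _ _ _ _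
  rw [this, mapL_tmul]; rfl

theorem norm_assoc (ξ : HilbertTensor H (HilbertTensor K L)) : ‖assoc H K L ξ‖ = ‖ξ‖ := by
  revert ξ
  refine induction (isClosed_eq (assoc H K L).continuous.norm continuous_norm) fun ξ => ?_
  rw [assoc, extend_coeL, (coeL _ _).norm_map]
  exact norm_assocAlg ξ

theorem ext₃ {E : Type*} [NormedAddCommGroup E] [NormedSpace ℂ E]
    {F G : HilbertTensor H (HilbertTensor K L) →L[ℂ] E}
    (h : ∀ x y v, F (tmul x (tmul y v)) = G (tmul x (tmul y v))) : F = G := by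
  refine ext fun x w => ?_
  have : F ∘L create (HilbertTensor K L) x = G ∘L create (HilbertTensor K L) x :=
    ext fun y v => h x y v
  exact DFunLike.congr_fun this w

theorem assoc_mapL (T : H →L[ℂ] H) (S : K →L[ℂ] K) (R : L →L[ℂ] L)
    (ξ : HilbertTensor H (HilbertTensor K L)) :
    assoc H K L (mapL T (mapL S R) ξ) = mapL (mapL T S) R (assoc H K L ξ) := by
  have : assoc H K L ∘L mapL T (mapL S R) = mapL (mapL T S) R ∘L assoc H K L :=
    ext₃ fun x y v => by simp
  exact DFunLike.congr_fun this ξ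

end HilbertTensor
end HilbertTensor

/-! ### Minimal tensor products of C*-algebras -/

theorem norm_starHom_le {A C : Type*} [CStarAlgebra A] [CStarAlgebra C] (f : A →⋆ₐ[ℂ] C) (a : A) :
    ‖f a‖ ≤ ‖a‖ := NonUnitalStarAlgHom.norm_apply_le f a

section StarLift

variable {R S C : Type*} [Ring R] [StarRing R] [Algebra ℂ R] [StarModule ℂ R]
  [Ring S] [StarRing S] [Algebra ℂ S] [StarModule ℂ S]
  [Ring C] [StarRing C] [Algebra ℂ C] [StarModule ℂ C]

/-- The star-homomorphism `a ⊗ b ↦ f a * g b` on the algebraic tensor product, for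
star-homomorphisms `f`, `g` with commuting ranges. -/
def starLift (f : R →⋆ₐ[ℂ] C) (g : S →⋆ₐ[ℂ] C) (h : ∀ a b, Commute (f a) (g b)) :
    R ⊗[ℂ] S →⋆ₐ[ℂ] C where
  __ := Algebra.TensorProduct.lift f.toAlgHom g.toAlgHom h
  map_star' x := by
    change Algebra.TensorProduct.lift f.toAlgHom g.toAlgHom h (star x) =
      star (Algebra.TensorProduct.lift f.toAlgHom g.toAlgHom h x)
    induction x with
    | zero => simp
    | add a b ha hb => rw [star_add, map_add, map_add, star_add, ha, hb]
    | tmul a b =>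
      rw [TensorProduct.star_tmul, Algebra.TensorProduct.lift_tmul,
        Algebra.TensorProduct.lift_tmul]
      change f (star a) * g (star b) = star (f a * g b)
      rw [(h a b).eq, star_mul, map_star, map_star]

@[simp] theorem starLift_tmul (f : R →⋆ₐ[ℂ] C) (g : S →⋆ₐ[ℂ] C)
    (h : ∀ a b, Commute (f a) (g b)) (a : R) (b : S) :
    starLift f g h (a ⊗ₜ b) = f a * g b :=
  Algebra.TensorProduct.lift_tmul f.toAlgHom g.toAlgHom h a b

theorem starHom_tensor_ext {F G : R ⊗[ℂ] S →⋆ₐ[ℂ] C}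
    (h : ∀ a b, F (a ⊗ₜ b) = G (a ⊗ₜ b)) : F = G := by
  refine DFunLike.ext _ _ fun x => ?_
  induction x with
  | zero => rw [map_zero, map_zero]
  | add a b ha hb => rw [map_add, map_add, ha, hb]
  | tmul a b => exact h a b

/-- `a ↦ a ⊗ 1` into the algebraic tensor product. -/
def algLeft (R S : Type*) [Ring R] [StarRing R] [Algebra ℂ R] [StarModule ℂ R]
    [Ring S] [StarRing S] [Algebra ℂ S] [StarModule ℂ S] : R →⋆ₐ[ℂ] R ⊗[ℂ] S where
  __ := (Algebra.TensorProduct.includeLeft : R →ₐ[ℂ] R ⊗[ℂ] S)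
  map_star' a := by
    change star a ⊗ₜ[ℂ] (1 : S) = star (a ⊗ₜ[ℂ] (1 : S))
    rw [TensorProduct.star_tmul, star_one]

/-- `b ↦ 1 ⊗ b` into the algebraic tensor product. -/
def algRight (R S : Type*) [Ring R] [StarRing R] [Algebra ℂ R] [StarModule ℂ R]
    [Ring S] [StarRing S] [Algebra ℂ S] [StarModule ℂ S] : S →⋆ₐ[ℂ] R ⊗[ℂ] S where
  __ := (Algebra.TensorProduct.includeRight : S →ₐ[ℂ] R ⊗[ℂ] S)
  map_star' a := by
    change (1 : R) ⊗ₜ[ℂ] star a = star ((1 : R) ⊗ₜ[ℂ] a)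
    rw [TensorProduct.star_tmul, star_one]

theorem algLeft_apply (a : R) : algLeft R S a = a ⊗ₜ 1 := rfl
theorem algRight_apply (b : S) : algRight R S b = 1 ⊗ₜ b := rfl

variable {H K : Type*} [NormedAddCommGroup H] [InnerProductSpace ℂ H] [CompleteSpace H]
  [NormedAddCommGroup K] [InnerProductSpace ℂ K] [CompleteSpace K]

theorem commute_rep (π : R →⋆ₐ[ℂ] (H →L[ℂ] H)) (τ : S →⋆ₐ[ℂ] (K →L[ℂ] K)) (a : R) (b : S) :
    Commute ((HilbertTensor.leftHom H K).comp π a) ((HilbertTensor.rightHom H K).comp τ b) :=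
  HilbertTensor.commute_left_right (π a) (τ b)

/-- The tensor product representation `π ⊗ τ` of the algebraic tensor product on the Hilbert space
tensor product: `a ⊗ b` acts as `π a ⊗ τ b`. -/
def tensorRep (π : R →⋆ₐ[ℂ] (H →L[ℂ] H)) (τ : S →⋆ₐ[ℂ] (K →L[ℂ] K)) :
    R ⊗[ℂ] S →⋆ₐ[ℂ] (HilbertTensor H K →L[ℂ] HilbertTensor H K) :=
  starLift (C := HilbertTensor H K →L[ℂ] HilbertTensor H K)
    ((HilbertTensor.leftHom H K).comp π) ((HilbertTensor.rightHom H K).comp τ) (commute_rep π τ)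

theorem tensorRep_tmul (π : R →⋆ₐ[ℂ] (H →L[ℂ] H)) (τ : S →⋆ₐ[ℂ] (K →L[ℂ] K)) (a : R) (b : S) :
    tensorRep π τ (a ⊗ₜ b) = HilbertTensor.mapL (π a) (τ b) := by
  rw [tensorRep, starLift_tmul]
  exact HilbertTensor.leftHom_mul_rightHom (π a) (τ b)

theorem norm_mapL_le (T : H →L[ℂ] H) (S : K →L[ℂ] K) :
    ‖HilbertTensor.mapL T S‖ ≤ ‖T‖ * ‖S‖ := by
  rw [← HilbertTensor.leftHom_mul_rightHom]
  refine (norm_mul_le _ _).trans ?_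
  gcongr
  · exact norm_starHom_le (HilbertTensor.leftHom H K) T
  · exact norm_starHom_le (HilbertTensor.rightHom H K) S

end StarLift

theorem continuous_starHom {A C : Type*} [CStarAlgebra A] [CStarAlgebra C]
    (f : A →⋆ₐ[ℂ] C) : Continuous f :=
  AddMonoidHomClass.continuous_of_bound f 1 fun x => by
    rw [one_mul]; exact norm_starHom_le f x

/-- In the completion for a supremum of C*-seminorms, norms are computed by any family of
star-homomorphisms implementing these C*-seminorms. -/
theorem CStarSeminorm.norm_le_of_forall {R : Type*} [Ring R] [StarRing R] [Algebra ℂ R]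
    [StarModule ℂ R] (S : Set (CStarSeminorm R)) (hS : ∀ x, ∃ c : ℝ, ∀ p ∈ S, p x ≤ c)
    (z : (sup S hS).Completion) (c : ℝ) (hc : 0 ≤ c)
    (h : ∀ p ∈ S, ∃ φ : (sup S hS).Completion → ℝ, (∀ x, φ ((sup S hS).of x) = p x) ∧
      (∀ x y, |φ x - φ y| ≤ ‖x - y‖) ∧ φ z ≤ c) : ‖z‖ ≤ c := by
  refine le_of_forall_pos_le_add fun ε hε => ?_
  obtain ⟨x, hx⟩ := (sup S hS).denseRange_of.exists_dist_lt z (half_pos hε)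
  rw [dist_eq_norm] at hx
  have h1 : ‖(sup S hS).of x‖ ≤ c + ε / 2 := by
    rw [norm_of]
    refine sup_le S hS x _ (by positivity) fun p hp => ?_
    obtain ⟨φ, h1, h2, h3⟩ := h p hp
    have := (le_abs_self _).trans (h2 ((sup S hS).of x) z)
    rw [norm_sub_rev] at this
    rw [← h1]
    linarith
  have h2 : ‖z‖ ≤ ‖z - (sup S hS).of x‖ + ‖(sup S hS).of x‖ := by
    simpa using norm_add_le (z - (sup S hS).of x) ((sup S hS).of x)
  linarith

theorem abs_norm_sub_norm_map_le {A C : Type*} [CStarAlgebra A] [CStarAlgebra C]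
    (f : A →⋆ₐ[ℂ] C) (x y : A) : |‖f x‖ - ‖f y‖| ≤ ‖x - y‖ :=
  (abs_norm_sub_norm_le _ _).trans (by
    rw [← map_sub]; exact norm_starHom_le f _)

universe w u v x

section MinTensor

variable (A : Type u) (B : Type v) (C : Type x) [CStarAlgebra A] [CStarAlgebra B] [CStarAlgebra C]

/-- The C*-seminorms `‖(π ⊗ τ)(·)‖` for representations `π` of `A` and `τ` of `B` on Hilbert spaces
(in the universe `w`). -/
def spatialSet : Set (CStarSeminorm (A ⊗[ℂ] B)) :=
  {p | ∃ (H : Type w) (_ : NormedAddCommGroup H) (_ : InnerProductSpace ℂ H) (_ : CompleteSpace H)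
    (K : Type w) (_ : NormedAddCommGroup K) (_ : InnerProductSpace ℂ K) (_ : CompleteSpace K)
    (π : A →⋆ₐ[ℂ] (H →L[ℂ] H)) (τ : B →⋆ₐ[ℂ] (K →L[ℂ] K)),
    p = CStarSeminorm.ofHom (C := HilbertTensor H K →L[ℂ] HilbertTensor H K) (tensorRep π τ)}

theorem spatialSet_bounded (z : A ⊗[ℂ] B) : ∃ c : ℝ, ∀ p ∈ spatialSet.{w} A B, p z ≤ c := by
  induction z with
  | zero =>
    refine ⟨0, fun p _ => (map_zero p.toSeminorm).le⟩
  | add a b ha hb =>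
    obtain ⟨c, hc⟩ := ha
    obtain ⟨d, hd⟩ := hb
    exact ⟨c + d, fun p hp => (map_add_le_add p.toSeminorm a b).trans
      (add_le_add (hc p hp) (hd p hp))⟩
  | tmul a b =>
    refine ⟨‖a‖ * ‖b‖, ?_⟩
    rintro p ⟨H, _, _, _, K, _, _, _, π, τ, rfl⟩
    rw [CStarSeminorm.ofHom_apply, tensorRep_tmul]
    exact (norm_mapL_le _ _).trans (mul_le_mul (norm_starHom_le _ _)
      (norm_starHom_le _ _) (norm_nonneg _) (norm_nonneg _))

/-- The minimal (spatial) C*-norm on the algebraic tensor product `A ⊗ B`: the supremum of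
`‖(π ⊗ τ)(z)‖` over representations `π` of `A` and `τ` of `B` on Hilbert spaces. The universe `w`
of the Hilbert spaces has to be at least that of `A` and of `B`. -/
def minSeminorm : CStarSeminorm (A ⊗[ℂ] B) :=
  CStarSeminorm.sup (spatialSet.{w} A B) (spatialSet_bounded A B)

/-- The minimal tensor product of C*-algebras. -/
def MinTensor : Type (max u v) := (minSeminorm.{w} A B).Completion

instance : CStarAlgebra (MinTensor.{w} A B) :=
  inferInstanceAs (CStarAlgebra (minSeminorm.{w} A B).Completion)

/-- The C*-seminorms `‖(π ⊗ (τ ⊗ υ))(·)‖` for representations of `A`, `B`, `C`. -/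
def spatialSet₃ : Set (CStarSeminorm (A ⊗[ℂ] (B ⊗[ℂ] C))) :=
  {p | ∃ (H : Type w) (_ : NormedAddCommGroup H) (_ : InnerProductSpace ℂ H) (_ : CompleteSpace H)
    (K : Type w) (_ : NormedAddCommGroup K) (_ : InnerProductSpace ℂ K) (_ : CompleteSpace K)
    (L : Type w) (_ : NormedAddCommGroup L) (_ : InnerProductSpace ℂ L) (_ : CompleteSpace L)
    (π : A →⋆ₐ[ℂ] (H →L[ℂ] H)) (τ : B →⋆ₐ[ℂ] (K →L[ℂ] K)) (υ : C →⋆ₐ[ℂ] (L →L[ℂ] L)),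
    p = CStarSeminorm.ofHom (C := HilbertTensor H (HilbertTensor K L) →L[ℂ]
      HilbertTensor H (HilbertTensor K L))
      (tensorRep π (tensorRep τ υ))}

theorem spatialSet₃_bounded (z : A ⊗[ℂ] (B ⊗[ℂ] C)) :
    ∃ c : ℝ, ∀ p ∈ spatialSet₃.{w} A B C, p z ≤ c := by
  induction z with
  | zero =>
    refine ⟨0, fun p _ => (map_zero p.toSeminorm).le⟩
  | add a b ha hb =>
    obtain ⟨c, hc⟩ := ha
    obtain ⟨d, hd⟩ := hb
    exact ⟨c + d, fun p hp => (map_add_le_add p.toSeminorm a b).trans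
      (add_le_add (hc p hp) (hd p hp))⟩
  | tmul a y =>
    obtain ⟨c, hc⟩ := spatialSet_bounded.{w} B C y
    refine ⟨‖a‖ * c, ?_⟩
    rintro p ⟨H, _, _, _, K, _, _, _, L, _, _, _, π, τ, υ, rfl⟩
    rw [CStarSeminorm.ofHom_apply, tensorRep_tmul]
    exact (norm_mapL_le _ _).trans (mul_le_mul (norm_starHom_le _ _)
      (hc (CStarSeminorm.ofHom (C := HilbertTensor K L →L[ℂ] HilbertTensor K L) (tensorRep τ υ)) ⟨K, _, _, _, L, _, _, _, τ, υ, rfl⟩)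
      (norm_nonneg _) (norm_nonneg _))

/-- The minimal C*-norm on the algebraic tensor product of three C*-algebras. -/
def minSeminorm₃ : CStarSeminorm (A ⊗[ℂ] (B ⊗[ℂ] C)) :=
  CStarSeminorm.sup (spatialSet₃.{w} A B C) (spatialSet₃_bounded A B C)

/-- The minimal tensor product `A ⊗ B ⊗ C` of three C*-algebras. -/
def MinTensor₃ : Type (max u v x) := (minSeminorm₃.{w} A B C).Completion

instance : CStarAlgebra (MinTensor₃.{w} A B C) :=
  inferInstanceAs (CStarAlgebra (minSeminorm₃.{w} A B C).Completion)

namespace MinTensor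

variable {A B C}

variable (A B C) in
/-- The canonical map of the algebraic into the minimal tensor product. -/
def of : A ⊗[ℂ] B →⋆ₐ[ℂ] MinTensor.{w} A B := (minSeminorm.{w} A B).of

variable (A B C) in
/-- The canonical map of the algebraic into the minimal tensor product of three C*-algebras. -/
def of₃ : A ⊗[ℂ] (B ⊗[ℂ] C) →⋆ₐ[ℂ] MinTensor₃.{w} A B C := (minSeminorm₃.{w} A B C).of

theorem norm_of (z : A ⊗[ℂ] B) : ‖of.{w} A B z‖ = minSeminorm.{w} A B z :=
  CStarSeminorm.norm_of _ z

theorem norm_of₃ (z : A ⊗[ℂ] (B ⊗[ℂ] C)) : ‖of₃.{w} A B C z‖ = minSeminorm₃.{w} A B C z :=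
  CStarSeminorm.norm_of _ z

theorem induction {P : MinTensor.{w} A B → Prop} (hc : IsClosed {x | P x})
    (h : ∀ x, P (of.{w} A B x)) (x : MinTensor.{w} A B) : P x :=
  CStarSeminorm.induction (minSeminorm.{w} A B) hc h x

theorem induction₃ {P : MinTensor₃.{w} A B C → Prop} (hc : IsClosed {x | P x})
    (h : ∀ x, P (of₃.{w} A B C x)) (x : MinTensor₃.{w} A B C) : P x :=
  CStarSeminorm.induction (minSeminorm₃.{w} A B C) hc h x

/-- Extension of a star-homomorphism from the algebraic to the minimal tensor product. -/
def lift {D : Type*} [CStarAlgebra D] (f : A ⊗[ℂ] B →⋆ₐ[ℂ] D)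
    (hf : ∀ z, ‖f z‖ ≤ minSeminorm.{w} A B z) : MinTensor.{w} A B →⋆ₐ[ℂ] D :=
  CStarSeminorm.lift f hf

theorem lift_of {D : Type*} [CStarAlgebra D] (f : A ⊗[ℂ] B →⋆ₐ[ℂ] D)
    (hf : ∀ z, ‖f z‖ ≤ minSeminorm.{w} A B z) (z : A ⊗[ℂ] B) :
    lift.{w} f hf (of.{w} A B z) = f z :=
  CStarSeminorm.lift_of f hf z

/-- Extension of a star-homomorphism from the algebraic to the minimal tensor product of three
C*-algebras. -/
def lift₃ {D : Type*} [CStarAlgebra D] (f : A ⊗[ℂ] (B ⊗[ℂ] C) →⋆ₐ[ℂ] D)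
    (hf : ∀ z, ‖f z‖ ≤ minSeminorm₃.{w} A B C z) : MinTensor₃.{w} A B C →⋆ₐ[ℂ] D :=
  CStarSeminorm.lift f hf

theorem lift₃_of₃ {D : Type*} [CStarAlgebra D] (f : A ⊗[ℂ] (B ⊗[ℂ] C) →⋆ₐ[ℂ] D)
    (hf : ∀ z, ‖f z‖ ≤ minSeminorm₃.{w} A B C z) (z : A ⊗[ℂ] (B ⊗[ℂ] C)) :
    lift₃.{w} f hf (of₃.{w} A B C z) = f z :=
  CStarSeminorm.lift_of f hf z

section Rep

variable {H : Type w} [NormedAddCommGroup H] [InnerProductSpace ℂ H] [CompleteSpace H]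
  {K : Type w} [NormedAddCommGroup K] [InnerProductSpace ℂ K] [CompleteSpace K]
  {L : Type w} [NormedAddCommGroup L] [InnerProductSpace ℂ L] [CompleteSpace L]

theorem norm_tensorRep_le (π : A →⋆ₐ[ℂ] (H →L[ℂ] H)) (τ : B →⋆ₐ[ℂ] (K →L[ℂ] K)) (z : A ⊗[ℂ] B) :
    ‖tensorRep π τ z‖ ≤ minSeminorm.{w} A B z :=
  have h : CStarSeminorm.ofHom (C := HilbertTensor H K →L[ℂ] HilbertTensor H K)
      (tensorRep π τ) ∈ spatialSet.{w} A B :=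
    ⟨H, inferInstance, inferInstance, inferInstance, K, inferInstance, inferInstance,
      inferInstance, π, τ, rfl⟩
  CStarSeminorm.le_sup (spatialSet.{w} A B) (spatialSet_bounded A B) _ h z

theorem norm_tensorRep₃_le (π : A →⋆ₐ[ℂ] (H →L[ℂ] H)) (τ : B →⋆ₐ[ℂ] (K →L[ℂ] K))
    (υ : C →⋆ₐ[ℂ] (L →L[ℂ] L)) (z : A ⊗[ℂ] (B ⊗[ℂ] C)) :
    ‖tensorRep π (tensorRep τ υ) z‖ ≤ minSeminorm₃.{w} A B C z :=
  have h : CStarSeminorm.ofHom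
      (C := HilbertTensor H (HilbertTensor K L) →L[ℂ] HilbertTensor H (HilbertTensor K L))
      (tensorRep π (tensorRep τ υ)) ∈ spatialSet₃.{w} A B C :=
    ⟨H, inferInstance, inferInstance, inferInstance, K, inferInstance, inferInstance,
      inferInstance, L, inferInstance, inferInstance, inferInstance, π, τ, υ, rfl⟩
  CStarSeminorm.le_sup (spatialSet₃.{w} A B C) (spatialSet₃_bounded A B C) _ h z

/-- The representation `π ⊗ τ` of the minimal tensor product. -/
def rep (π : A →⋆ₐ[ℂ] (H →L[ℂ] H)) (τ : B →⋆ₐ[ℂ] (K →L[ℂ] K)) :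
    MinTensor.{w} A B →⋆ₐ[ℂ] (HilbertTensor H K →L[ℂ] HilbertTensor H K) :=
  lift.{w} (tensorRep π τ) (norm_tensorRep_le π τ)

/-- The representation `π ⊗ (τ ⊗ υ)` of the minimal tensor product of three C*-algebras. -/
def rep₃ (π : A →⋆ₐ[ℂ] (H →L[ℂ] H)) (τ : B →⋆ₐ[ℂ] (K →L[ℂ] K)) (υ : C →⋆ₐ[ℂ] (L →L[ℂ] L)) :
    MinTensor₃.{w} A B C →⋆ₐ[ℂ] (HilbertTensor H (HilbertTensor K L) →L[ℂ]
      HilbertTensor H (HilbertTensor K L)) :=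
  lift₃.{w} (tensorRep π (tensorRep τ υ)) (norm_tensorRep₃_le π τ υ)

end Rep

/-- `a ↦ a ⊗ 1`. -/
def inl : A →⋆ₐ[ℂ] MinTensor.{w} A B := (of.{w} A B).comp (algLeft A B)

/-- `b ↦ 1 ⊗ b`. -/
def inr : B →⋆ₐ[ℂ] MinTensor.{w} A B := (of.{w} A B).comp (algRight A B)

theorem commute_inl_inr (a : A) (b : B) :
    Commute (inl.{w} a : MinTensor.{w} A B) (inr.{w} b : MinTensor.{w} A B) := by
  change of.{w} A B (a ⊗ₜ 1) * of.{w} A B (1 ⊗ₜ b) =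
    of.{w} A B (1 ⊗ₜ b) * of.{w} A B (a ⊗ₜ 1)
  rw [← map_mul, ← map_mul]
  simp

/-- The elementary tensor `a ⊗ b` in the minimal tensor product. -/
def tmul (a : A) (b : B) : MinTensor.{w} A B := of.{w} A B (a ⊗ₜ b)

theorem inl_mul_inr (a : A) (b : B) :
    (inl.{w} a * inr.{w} b : MinTensor.{w} A B) = tmul.{w} a b := by
  change of.{w} A B (a ⊗ₜ 1) * of.{w} A B (1 ⊗ₜ b) = _
  rw [← map_mul]
  simp [tmul]

theorem tmul_mul_tmul (a a' : A) (b b' : B) :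
    (tmul.{w} a b * tmul.{w} a' b' : MinTensor.{w} A B) = tmul.{w} (a * a') (b * b') := by
  simp only [tmul]
  rw [← map_mul, Algebra.TensorProduct.tmul_mul_tmul]

theorem norm_le_of_forall_rep (z : MinTensor.{w} A B) (c : ℝ) (hc : 0 ≤ c)
    (h : ∀ (H : Type w) [NormedAddCommGroup H] [InnerProductSpace ℂ H] [CompleteSpace H]
      (K : Type w) [NormedAddCommGroup K] [InnerProductSpace ℂ K] [CompleteSpace K]
      (π : A →⋆ₐ[ℂ] (H →L[ℂ] H)) (τ : B →⋆ₐ[ℂ] (K →L[ℂ] K)), ‖rep.{w} π τ z‖ ≤ c) :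
    ‖z‖ ≤ c := by
  refine CStarSeminorm.norm_le_of_forall (spatialSet.{w} A B) (spatialSet_bounded A B) z c hc ?_
  rintro p ⟨H, _, _, _, K, _, _, _, π, τ, rfl⟩
  exact ⟨fun y => ‖rep.{w} π τ y‖, fun y => congrArg norm (lift_of _ (norm_tensorRep_le π τ) y),
    abs_norm_sub_norm_map_le _, h H K π τ⟩

theorem norm_le_of_forall_rep₃ (z : MinTensor₃.{w} A B C) (c : ℝ) (hc : 0 ≤ c)
    (h : ∀ (H : Type w) [NormedAddCommGroup H] [InnerProductSpace ℂ H] [CompleteSpace H]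
      (K : Type w) [NormedAddCommGroup K] [InnerProductSpace ℂ K] [CompleteSpace K]
      (L : Type w) [NormedAddCommGroup L] [InnerProductSpace ℂ L] [CompleteSpace L]
      (π : A →⋆ₐ[ℂ] (H →L[ℂ] H)) (τ : B →⋆ₐ[ℂ] (K →L[ℂ] K)) (υ : C →⋆ₐ[ℂ] (L →L[ℂ] L)),
      ‖rep₃.{w} π τ υ z‖ ≤ c) :
    ‖z‖ ≤ c := by
  refine CStarSeminorm.norm_le_of_forall (spatialSet₃.{w} A B C) (spatialSet₃_bounded A B C) z c
    hc ?_
  rintro p ⟨H, _, _, _, K, _, _, _, L, _, _, _, π, τ, υ, rfl⟩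
  exact ⟨fun y => ‖rep₃.{w} π τ υ y‖, fun y => congrArg norm (lift₃_of₃ _ (norm_tensorRep₃_le π τ υ) y),
    abs_norm_sub_norm_map_le _, h H K L π τ υ⟩

@[simp] theorem rep_tmul {H : Type w} [NormedAddCommGroup H] [InnerProductSpace ℂ H]
    [CompleteSpace H] {K : Type w} [NormedAddCommGroup K] [InnerProductSpace ℂ K] [CompleteSpace K]
    (π : A →⋆ₐ[ℂ] (H →L[ℂ] H)) (τ : B →⋆ₐ[ℂ] (K →L[ℂ] K)) (a : A) (b : B) :
    rep.{w} π τ (tmul.{w} a b) = HilbertTensor.mapL (π a) (τ b) :=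
  (lift_of _ (norm_tensorRep_le π τ) _).trans (tensorRep_tmul π τ a b)

section Map

variable {A' : Type*} {B' : Type*} [CStarAlgebra A'] [CStarAlgebra B']

theorem commute_map (f : A →⋆ₐ[ℂ] A') (g : B →⋆ₐ[ℂ] B') (a : A) (b : B) :
    Commute ((inl.{w} : A' →⋆ₐ[ℂ] MinTensor.{w} A' B').comp f a)
      ((inr.{w} : B' →⋆ₐ[ℂ] MinTensor.{w} A' B').comp g b) :=
  commute_inl_inr (f a) (g b)

/-- `f ⊗ g` on the algebraic tensor product. -/
def mapAlg (f : A →⋆ₐ[ℂ] A') (g : B →⋆ₐ[ℂ] B') : A ⊗[ℂ] B →⋆ₐ[ℂ] MinTensor.{w} A' B' :=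
  starLift (inl.comp f) (inr.comp g) (commute_map f g)

theorem mapAlg_tmul (f : A →⋆ₐ[ℂ] A') (g : B →⋆ₐ[ℂ] B') (a : A) (b : B) :
    mapAlg.{w} f g (a ⊗ₜ b) = tmul.{w} (f a) (g b) :=
  (starLift_tmul _ _ (commute_map f g) a b).trans (inl_mul_inr (f a) (g b))

theorem norm_mapAlg_le (f : A →⋆ₐ[ℂ] A') (g : B →⋆ₐ[ℂ] B') (z : A ⊗[ℂ] B) :
    ‖mapAlg.{w} f g z‖ ≤ minSeminorm.{w} A B z := by
  refine norm_le_of_forall_rep _ _ (CStarSeminorm.apply_nonneg _ _) fun H _ _ _ K _ _ _ π τ => ?_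
  have : (rep.{w} π τ).comp (mapAlg.{w} f g) = tensorRep (π.comp f) (τ.comp g) :=
    starHom_tensor_ext fun a b => by
      rw [StarAlgHom.comp_apply, mapAlg_tmul, rep_tmul, tensorRep_tmul]; rfl
  rw [← StarAlgHom.comp_apply, this]
  exact norm_tensorRep_le _ _ z

/-- The star-homomorphism `f ⊗ g` between minimal tensor products, `a ⊗ b ↦ f a ⊗ g b`. -/
def map (f : A →⋆ₐ[ℂ] A') (g : B →⋆ₐ[ℂ] B') : MinTensor.{w} A B →⋆ₐ[ℂ] MinTensor.{w} A' B' :=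
  lift.{w} (mapAlg.{w} f g) (norm_mapAlg_le f g)

@[simp] theorem map_tmul (f : A →⋆ₐ[ℂ] A') (g : B →⋆ₐ[ℂ] B') (a : A) (b : B) :
    map.{w} f g (tmul.{w} a b) = tmul.{w} (f a) (g b) :=
  (lift_of _ (norm_mapAlg_le f g) _).trans (mapAlg_tmul f g a b)

end Map

theorem hom_ext {D : Type*} [CStarAlgebra D] {F G : MinTensor.{w} A B →⋆ₐ[ℂ] D}
    (h : ∀ a b, F (tmul.{w} a b) = G (tmul.{w} a b)) : F = G :=
  CStarSeminorm.hom_ext fun x => DFunLike.congr_fun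
    (starHom_tensor_ext (F := F.comp (of.{w} A B))
      (G := G.comp (of.{w} A B)) h) x

/-! #### The canonical maps to the triple tensor product -/

/-- The elementary tensor `a ⊗ b ⊗ c`. -/
def tmul₃ (a : A) (b : B) (c : C) : MinTensor₃.{w} A B C :=
  of₃.{w} A B C (a ⊗ₜ (b ⊗ₜ c))

theorem tmul₃_mul_tmul₃ (a a' : A) (b b' : B) (c c' : C) :
    (tmul₃.{w} a b c * tmul₃.{w} a' b' c' : MinTensor₃.{w} A B C) =
      tmul₃.{w} (a * a') (b * b') (c * c') := by
  simp only [tmul₃]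
  rw [← map_mul, Algebra.TensorProduct.tmul_mul_tmul, Algebra.TensorProduct.tmul_mul_tmul]

section Triple

variable {H : Type w} [NormedAddCommGroup H] [InnerProductSpace ℂ H] [CompleteSpace H]
  {K : Type w} [NormedAddCommGroup K] [InnerProductSpace ℂ K] [CompleteSpace K]
  {L : Type w} [NormedAddCommGroup L] [InnerProductSpace ℂ L] [CompleteSpace L]

@[simp] theorem rep₃_tmul₃ (π : A →⋆ₐ[ℂ] (H →L[ℂ] H)) (τ : B →⋆ₐ[ℂ] (K →L[ℂ] K))
    (υ : C →⋆ₐ[ℂ] (L →L[ℂ] L)) (a : A) (b : B) (c : C) :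
    rep₃.{w} π τ υ (tmul₃.{w} a b c) =
      HilbertTensor.mapL (π a) (HilbertTensor.mapL (τ b) (υ c)) := by
  refine (lift₃_of₃ _ (norm_tensorRep₃_le π τ υ) _).trans ?_
  rw [tensorRep_tmul, tensorRep_tmul]

variable (A B C)

/-- `a ↦ a ⊗ 1 ⊗ 1`. -/
def in₁ : A →⋆ₐ[ℂ] MinTensor₃.{w} A B C :=
  (of₃.{w} A B C).comp (algLeft A (B ⊗[ℂ] C))

/-- `c ↦ 1 ⊗ 1 ⊗ c`. -/
def in₃ : C →⋆ₐ[ℂ] MinTensor₃.{w} A B C :=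
  (of₃.{w} A B C).comp ((algRight A (B ⊗[ℂ] C)).comp (algRight B C))

/-- `b ⊗ c ↦ 1 ⊗ b ⊗ c` on the algebraic tensor product. -/
def in₂₃Alg : B ⊗[ℂ] C →⋆ₐ[ℂ] MinTensor₃.{w} A B C :=
  (of₃.{w} A B C).comp (algRight A (B ⊗[ℂ] C))

/-- `a ⊗ b ↦ a ⊗ b ⊗ 1` on the algebraic tensor product. -/
def in₁₂Alg : A ⊗[ℂ] B →⋆ₐ[ℂ] MinTensor₃.{w} A B C :=
  (of₃.{w} A B C).comp
    (starLift (algLeft A (B ⊗[ℂ] C)) ((algRight A (B ⊗[ℂ] C)).comp (algLeft B C)) fun a b => by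
      change (a ⊗ₜ[ℂ] (1 : B ⊗[ℂ] C)) * ((1 : A) ⊗ₜ[ℂ] (b ⊗ₜ[ℂ] (1 : C))) =
        ((1 : A) ⊗ₜ[ℂ] (b ⊗ₜ[ℂ] (1 : C))) * (a ⊗ₜ[ℂ] (1 : B ⊗[ℂ] C))
      rw [Algebra.TensorProduct.tmul_mul_tmul, Algebra.TensorProduct.tmul_mul_tmul,
        one_mul, one_mul, mul_one, mul_one])

variable {A B C}

theorem in₁₂Alg_tmul (a : A) (b : B) : in₁₂Alg.{w} A B C (a ⊗ₜ b) = tmul₃.{w} a b 1 := by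
  rw [in₁₂Alg, StarAlgHom.comp_apply, starLift_tmul]
  change of₃.{w} A B C ((a ⊗ₜ[ℂ] (1 : B ⊗[ℂ] C)) *
    ((1 : A) ⊗ₜ[ℂ] (b ⊗ₜ[ℂ] (1 : C)))) = _
  rw [Algebra.TensorProduct.tmul_mul_tmul, one_mul, mul_one]
  rfl

theorem norm_in₂₃Alg_le (y : B ⊗[ℂ] C) : ‖in₂₃Alg.{w} A B C y‖ ≤ minSeminorm.{w} B C y := by
  refine norm_le_of_forall_rep₃ _ _ (CStarSeminorm.apply_nonneg _ _)
    fun H _ _ _ K _ _ _ L _ _ _ π τ υ => ?_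
  have : rep₃.{w} π τ υ (in₂₃Alg.{w} A B C y) = HilbertTensor.rightHom H _ (tensorRep τ υ y) := by
    refine (lift₃_of₃ _ (norm_tensorRep₃_le π τ υ) _).trans ?_
    refine (tensorRep_tmul π (tensorRep τ υ) 1 y).trans ?_
    rw [map_one]; rfl
  rw [this]
  exact (norm_starHom_le (HilbertTensor.rightHom H (HilbertTensor K L)) _).trans
    (norm_tensorRep_le τ υ y)

/-- In the representation `π ⊗ (τ ⊗ υ)`, transported by `H ⊗ (K ⊗ L) → (H ⊗ K) ⊗ L`, the element
`z ⊗ 1` acts as `(π ⊗ τ)(z) ⊗ 1`. -/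
theorem assoc_in₁₂Alg (π : A →⋆ₐ[ℂ] (H →L[ℂ] H)) (τ : B →⋆ₐ[ℂ] (K →L[ℂ] K))
    (υ : C →⋆ₐ[ℂ] (L →L[ℂ] L)) (z : A ⊗[ℂ] B) (ξ : HilbertTensor H (HilbertTensor K L)) :
    HilbertTensor.assoc H K L (rep₃.{w} π τ υ (in₁₂Alg.{w} A B C z) ξ) =
      HilbertTensor.leftHom (HilbertTensor H K) L (tensorRep π τ z)
        (HilbertTensor.assoc H K L ξ) := by
  induction z with
  | zero => simp
  | add a b ha hb =>
    rw [map_add, map_add, map_add, map_add, add_apply,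
      add_apply, map_add, ha, hb]
  | tmul a b =>
    rw [in₁₂Alg_tmul, rep₃_tmul₃, HilbertTensor.assoc_mapL, tensorRep_tmul, map_one]
    rfl

theorem norm_le_of_assoc {X : HilbertTensor H (HilbertTensor K L) →L[ℂ]
      HilbertTensor H (HilbertTensor K L)}
    {Y : HilbertTensor (HilbertTensor H K) L →L[ℂ] HilbertTensor (HilbertTensor H K) L}
    (h : ∀ ξ, HilbertTensor.assoc H K L (X ξ) = Y (HilbertTensor.assoc H K L ξ)) :
    ‖X‖ ≤ ‖Y‖ := by
  refine ContinuousLinearMap.opNorm_le_bound _ (norm_nonneg _) fun ξ => ?_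
  rw [← HilbertTensor.norm_assoc, h, ← HilbertTensor.norm_assoc ξ]
  exact Y.le_opNorm _

theorem norm_in₁₂Alg_le (z : A ⊗[ℂ] B) : ‖in₁₂Alg.{w} A B C z‖ ≤ minSeminorm.{w} A B z := by
  refine norm_le_of_forall_rep₃ _ _ (CStarSeminorm.apply_nonneg _ _)
    fun H _ _ _ K _ _ _ L _ _ _ π τ υ => ?_
  refine (norm_le_of_assoc (assoc_in₁₂Alg π τ υ z)).trans ?_
  exact (norm_starHom_le (HilbertTensor.leftHom (HilbertTensor H K) L) _).trans
    (norm_tensorRep_le π τ z)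

variable (A B C)

/-- `b ⊗ c ↦ 1 ⊗ b ⊗ c`. -/
def in₂₃ : MinTensor.{w} B C →⋆ₐ[ℂ] MinTensor₃.{w} A B C :=
  lift.{w} (in₂₃Alg.{w} A B C) norm_in₂₃Alg_le

/-- `a ⊗ b ↦ a ⊗ b ⊗ 1`. -/
def in₁₂ : MinTensor.{w} A B →⋆ₐ[ℂ] MinTensor₃.{w} A B C :=
  lift.{w} (in₁₂Alg.{w} A B C) norm_in₁₂Alg_le

variable {A B C}

theorem in₁_eq (a : A) : in₁.{w} A B C a = tmul₃.{w} a 1 1 := rfl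

theorem in₃_eq (c : C) : in₃.{w} A B C c = tmul₃.{w} 1 1 c := rfl

theorem in₂₃_tmul (b : B) (c : C) : in₂₃.{w} A B C (tmul.{w} b c) = tmul₃.{w} 1 b c :=
  lift_of _ norm_in₂₃Alg_le _

theorem in₁₂_tmul (a : A) (b : B) : in₁₂.{w} A B C (tmul.{w} a b) = tmul₃.{w} a b 1 :=
  (lift_of _ norm_in₁₂Alg_le _).trans (in₁₂Alg_tmul a b)

theorem commute_in₁_in₂₃ (a : A) (y : MinTensor.{w} B C) :
    Commute (in₁.{w} A B C a) (in₂₃.{w} A B C y) := by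
  revert y
  refine induction ?_ fun y => ?_
  · have hc : Continuous (in₂₃.{w} A B C) := continuous_starHom _
    exact isClosed_eq (continuous_const.mul hc) (hc.mul continuous_const)
  · have : in₂₃.{w} A B C (of.{w} B C y) = in₂₃Alg.{w} A B C y :=
      lift_of _ norm_in₂₃Alg_le _
    change in₁.{w} A B C a * in₂₃.{w} A B C (of.{w} B C y) =
      in₂₃.{w} A B C (of.{w} B C y) * in₁.{w} A B C a
    rw [this]
    change of₃.{w} A B C (a ⊗ₜ 1) * of₃.{w} A B C (1 ⊗ₜ y) =
      of₃.{w} A B C (1 ⊗ₜ y) * of₃.{w} A B C (a ⊗ₜ 1)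
    rw [← map_mul, ← map_mul, Algebra.TensorProduct.tmul_mul_tmul,
      Algebra.TensorProduct.tmul_mul_tmul, one_mul, one_mul, mul_one, mul_one]

theorem commute_in₁₂_in₃ (z : MinTensor.{w} A B) (c : C) :
    Commute (in₁₂.{w} A B C z) (in₃.{w} A B C c) := by
  revert z
  refine induction ?_ fun z => ?_
  · have hc : Continuous (in₁₂.{w} A B C) := continuous_starHom _
    exact isClosed_eq (hc.mul continuous_const) (continuous_const.mul hc)
  · have : in₁₂.{w} A B C (of.{w} A B z) = in₁₂Alg.{w} A B C z :=
      lift_of _ norm_in₁₂Alg_le _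
    change in₁₂.{w} A B C (of.{w} A B z) * in₃.{w} A B C c =
      in₃.{w} A B C c * in₁₂.{w} A B C (of.{w} A B z)
    rw [this, in₃_eq]
    clear this
    induction z with
    | zero => rw [map_zero, zero_mul, mul_zero]
    | add a b ha hb => rw [map_add, add_mul, mul_add, ha, hb]
    | tmul a b =>
      rw [in₁₂Alg_tmul, tmul₃_mul_tmul₃, tmul₃_mul_tmul₃]
      simp

variable (A B C)

/-- `a ⊗ y ↦ a ⊗ y` on the algebraic tensor product of `A` and `B ⊗ C`. -/
def assocRAlg : A ⊗[ℂ] MinTensor.{w} B C →⋆ₐ[ℂ] MinTensor₃.{w} A B C :=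
  starLift (in₁.{w} A B C) (in₂₃.{w} A B C) commute_in₁_in₂₃

/-- `z ⊗ c ↦ z ⊗ c` on the algebraic tensor product of `A ⊗ B` and `C`. -/
def assocLAlg : MinTensor.{w} A B ⊗[ℂ] C →⋆ₐ[ℂ] MinTensor₃.{w} A B C :=
  starLift (in₁₂.{w} A B C) (in₃.{w} A B C) commute_in₁₂_in₃

variable {A B C}

theorem norm_assocRAlg_le (x : A ⊗[ℂ] MinTensor.{w} B C) :
    ‖assocRAlg.{w} A B C x‖ ≤ minSeminorm.{w} A (MinTensor.{w} B C) x := by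
  refine norm_le_of_forall_rep₃ _ _ (CStarSeminorm.apply_nonneg _ _)
    fun H _ _ _ K _ _ _ L _ _ _ π τ υ => ?_
  have h1 : (rep₃.{w} π τ υ).comp (in₂₃.{w} A B C) =
      (HilbertTensor.rightHom H (HilbertTensor K L)).comp (rep.{w} τ υ) :=
    hom_ext (D := HilbertTensor H (HilbertTensor K L) →L[ℂ] HilbertTensor H (HilbertTensor K L))
      fun b c => by
        rw [StarAlgHom.comp_apply, StarAlgHom.comp_apply, in₂₃_tmul, rep₃_tmul₃, rep_tmul, map_one]
        rfl
  have h2 : (rep₃.{w} π τ υ).comp (assocRAlg.{w} A B C) = tensorRep π (rep.{w} τ υ) :=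
    starHom_tensor_ext
      (C := HilbertTensor H (HilbertTensor K L) →L[ℂ] HilbertTensor H (HilbertTensor K L))
      fun a y => by
        have h3 : rep₃.{w} π τ υ (in₂₃.{w} A B C y) =
            HilbertTensor.mapL 1 (rep.{w} τ υ y) := DFunLike.congr_fun h1 y
        rw [StarAlgHom.comp_apply, assocRAlg, starLift_tmul, map_mul, tensorRep_tmul, h3,
          in₁_eq, rep₃_tmul₃, map_one, map_one, HilbertTensor.mapL_one,
          ← HilbertTensor.mapL_mul, mul_one, one_mul]
  rw [← StarAlgHom.comp_apply, h2]
  exact norm_tensorRep_le π (rep.{w} τ υ) x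

theorem norm_assocLAlg_le (x : MinTensor.{w} A B ⊗[ℂ] C) :
    ‖assocLAlg.{w} A B C x‖ ≤ minSeminorm.{w} (MinTensor.{w} A B) C x := by
  refine norm_le_of_forall_rep₃ _ _ (CStarSeminorm.apply_nonneg _ _)
    fun H _ _ _ K _ _ _ L _ _ _ π τ υ => ?_
  have h1 : ∀ (z : MinTensor.{w} A B) (ξ : HilbertTensor H (HilbertTensor K L)),
      HilbertTensor.assoc H K L (rep₃.{w} π τ υ (in₁₂.{w} A B C z) ξ) =
        HilbertTensor.leftHom (HilbertTensor H K) L (rep.{w} π τ z)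
          (HilbertTensor.assoc H K L ξ) := fun z ξ => by
    revert z
    refine induction ?_ fun z => ?_
    · have c1 : Continuous (fun z => rep₃.{w} π τ υ (in₁₂.{w} A B C z)) :=
        continuous_starHom ((rep₃.{w} π τ υ).comp (in₁₂.{w} A B C))
      have c2 : Continuous (fun z => HilbertTensor.leftHom (HilbertTensor H K) L
          (rep.{w} π τ z)) := continuous_starHom
            ((HilbertTensor.leftHom (HilbertTensor H K) L).comp (rep.{w} π τ))
      exact isClosed_eq
        ((HilbertTensor.assoc H K L).continuous.comp (c1.clm_apply continuous_const))
        (c2.clm_apply continuous_const)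
    · have e1 : in₁₂.{w} A B C (of.{w} A B z) = in₁₂Alg.{w} A B C z :=
        lift_of _ norm_in₁₂Alg_le _
      have e2 : rep.{w} π τ (of.{w} A B z) = tensorRep π τ z :=
        lift_of _ (norm_tensorRep_le π τ) _
      change HilbertTensor.assoc H K L
          (rep₃.{w} π τ υ (in₁₂.{w} A B C (of.{w} A B z)) ξ) =
        HilbertTensor.leftHom (HilbertTensor H K) L (rep.{w} π τ (of.{w} A B z))
          (HilbertTensor.assoc H K L ξ)
      rw [e1, e2]
      exact assoc_in₁₂Alg π τ υ z ξ
  refine (norm_le_of_assoc (Y := tensorRep (rep.{w} π τ) υ x) fun ξ => ?_).trans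
    (norm_tensorRep_le (rep.{w} π τ) υ x)
  induction x generalizing ξ with
  | zero => simp
  | add a b ha hb =>
    rw [map_add, map_add, map_add, add_apply,
      add_apply, map_add, ha, hb]
  | tmul z c =>
    rw [assocLAlg, starLift_tmul, map_mul, tensorRep_tmul]
    change HilbertTensor.assoc H K L (rep₃.{w} π τ υ (in₁₂.{w} A B C z)
      (rep₃.{w} π τ υ (in₃.{w} A B C c) ξ)) = _
    rw [h1, in₃_eq, rep₃_tmul₃, HilbertTensor.assoc_mapL, map_one, map_one, HilbertTensor.mapL_one]
    have h4 := DFunLike.congr_fun (HilbertTensor.mapL_mul (rep.{w} π τ z) 1 1 (υ c))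
      (HilbertTensor.assoc H K L ξ)
    rw [mul_one, one_mul] at h4
    exact h4.symm

end Triple

variable (A B C)

/-- The canonical identification of `A ⊗ (B ⊗ C)` with `A ⊗ B ⊗ C`. -/
def assocR : MinTensor.{w} A (MinTensor.{w} B C) →⋆ₐ[ℂ] MinTensor₃.{w} A B C :=
  lift.{w} (assocRAlg.{w} A B C) norm_assocRAlg_le

/-- The canonical identification of `(A ⊗ B) ⊗ C` with `A ⊗ B ⊗ C`. -/
def assocL : MinTensor.{w} (MinTensor.{w} A B) C →⋆ₐ[ℂ] MinTensor₃.{w} A B C :=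
  lift.{w} (assocLAlg.{w} A B C) norm_assocLAlg_le

variable {A B C}

@[simp] theorem assocR_tmul (a : A) (b : B) (c : C) :
    assocR.{w} A B C (tmul.{w} a (tmul.{w} b c)) = tmul₃.{w} a b c := by
  refine (lift_of _ norm_assocRAlg_le _).trans ?_
  rw [assocRAlg, starLift_tmul, in₂₃_tmul, in₁_eq, tmul₃_mul_tmul₃, one_mul, one_mul, mul_one]

@[simp] theorem assocL_tmul (a : A) (b : B) (c : C) :
    assocL.{w} A B C (tmul.{w} (tmul.{w} a b) c) = tmul₃.{w} a b c := by
  refine (lift_of _ norm_assocLAlg_le _).trans ?_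
  rw [assocLAlg, starLift_tmul, in₁₂_tmul, in₃_eq, tmul₃_mul_tmul₃, one_mul, mul_one, mul_one]

end MinTensor

end MinTensor

/-! ### The (full) group C*-algebra of a discrete group -/

namespace GroupAlgebra

variable {Γ : Type*} [Group Γ]

/-- The conjugate-linear extension of `g ↦ g⁻¹` to the group algebra. -/
def starHom : MonoidAlgebra ℂ Γ →+ MonoidAlgebra ℂ Γ :=
  (Finsupp.liftAddHom fun g : Γ => (MonoidAlgebra.singleAddHom (g⁻¹)).comp
    (starAddEquiv : ℂ ≃+ ℂ).toAddMonoidHom).comp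
    (MonoidAlgebra.coeffAddEquiv (R := ℂ) (M := Γ)).toAddMonoidHom

theorem starHom_single (g : Γ) (c : ℂ) :
    starHom (MonoidAlgebra.single g c) = MonoidAlgebra.single g⁻¹ (star c) := by
  change Finsupp.liftAddHom _ (Finsupp.single g c) = _
  rw [Finsupp.liftAddHom_apply_single]
  rfl

instance : StarRing (MonoidAlgebra ℂ Γ) where
  star := starHom
  star_involutive x := by
    induction x using MonoidAlgebra.induction_linear with
    | zero => rw [map_zero, map_zero]
    | add x y hx hy => rw [map_add, map_add, hx, hy]
    | single g c => rw [starHom_single, starHom_single, inv_inv, star_star]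
  star_mul x y := by
    induction x using MonoidAlgebra.induction_linear with
    | zero => rw [zero_mul, map_zero, mul_zero]
    | add x x' hx hx' => rw [add_mul, map_add, hx, hx', map_add, mul_add]
    | single g c =>
      induction y using MonoidAlgebra.induction_linear with
      | zero => rw [mul_zero, map_zero, zero_mul]
      | add x x' hx hx' => rw [mul_add, map_add, hx, hx', map_add, add_mul]
      | single h d =>
        rw [MonoidAlgebra.single_mul_single, starHom_single, starHom_single, starHom_single,
          MonoidAlgebra.single_mul_single, mul_inv_rev, star_mul]
  star_add := map_add starHom

theorem star_single (g : Γ) (c : ℂ) :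
    star (MonoidAlgebra.single g c) = MonoidAlgebra.single g⁻¹ (star c) := starHom_single g c

instance : StarModule ℂ (MonoidAlgebra ℂ Γ) where
  star_smul a x := by
    induction x using MonoidAlgebra.induction_linear with
    | zero => rw [smul_zero, star_zero, smul_zero]
    | add x y hx hy => rw [smul_add, star_add, hx, hy, star_add, smul_add]
    | single g c =>
      rw [MonoidAlgebra.smul_single, star_single, star_single, MonoidAlgebra.smul_single,
        smul_eq_mul, smul_eq_mul, star_mul, mul_comm]

/-- The star-homomorphism of the group algebra that extends a unitary representation. -/
def starLift {C : Type*} [Ring C] [StarRing C] [Algebra ℂ C] [StarModule ℂ C]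
    (u : Γ →* C) (hu : ∀ g, u g⁻¹ = star (u g)) : MonoidAlgebra ℂ Γ →⋆ₐ[ℂ] C where
  __ := MonoidAlgebra.lift ℂ C Γ u
  map_star' x := by
    change MonoidAlgebra.lift ℂ C Γ u (star x) = star (MonoidAlgebra.lift ℂ C Γ u x)
    induction x using MonoidAlgebra.induction_linear with
    | zero => rw [star_zero, map_zero, star_zero]
    | add x y hx hy => rw [star_add, map_add, hx, hy, map_add, star_add]
    | single g c =>
      rw [star_single, MonoidAlgebra.lift_single, MonoidAlgebra.lift_single, hu, star_smul]

theorem starLift_single {C : Type*} [Ring C] [StarRing C] [Algebra ℂ C] [StarModule ℂ C]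
    (u : Γ →* C) (hu : ∀ g, u g⁻¹ = star (u g)) (g : Γ) :
    starLift u hu (MonoidAlgebra.single g 1) = u g :=
  (MonoidAlgebra.lift_single u g 1).trans (one_smul _ _)

theorem seminorm_single_le (p : CStarSeminorm (MonoidAlgebra ℂ Γ)) (g : Γ) :
    p (MonoidAlgebra.single g 1) ≤ 1 := by
  have h := p.star_mul_self_apply (MonoidAlgebra.single g 1)
  rw [star_single, MonoidAlgebra.single_mul_single, inv_mul_cancel, star_one, one_mul] at h
  have h1 : p (MonoidAlgebra.single 1 1) ≤ 1 := p.one_apply_le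
  by_contra! hlt
  nlinarith

theorem seminorm_bounded (x : MonoidAlgebra ℂ Γ) :
    ∃ c : ℝ, ∀ p ∈ (Set.univ : Set (CStarSeminorm (MonoidAlgebra ℂ Γ))), p x ≤ c := by
  induction x using MonoidAlgebra.induction_linear with
  | zero => exact ⟨0, fun p _ => (map_zero p.toSeminorm).le⟩
  | add a b ha hb =>
    obtain ⟨c, hc⟩ := ha
    obtain ⟨d, hd⟩ := hb
    exact ⟨c + d, fun p hp => (map_add_le_add p.toSeminorm a b).trans
      (add_le_add (hc p hp) (hd p hp))⟩
  | single g c =>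
    refine ⟨‖c‖, fun p _ => ?_⟩
    have h : (MonoidAlgebra.single g c : MonoidAlgebra ℂ Γ) = c • MonoidAlgebra.single g 1 := by
      rw [MonoidAlgebra.smul_single, smul_eq_mul, mul_one]
    rw [h, map_smul_eq_mul p.toSeminorm]
    exact mul_le_of_le_one_right (norm_nonneg c) (seminorm_single_le p g)

end GroupAlgebra

/-- The largest C*-seminorm on the group algebra. -/
def maxSeminorm (Γ : Type*) [Group Γ] : CStarSeminorm (MonoidAlgebra ℂ Γ) :=
  CStarSeminorm.sup Set.univ GroupAlgebra.seminorm_bounded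

/-- The group C*-algebra `C*(Γ)`: the completion of the group algebra `ℂ[Γ]` in the largest
C*-seminorm. -/
def GroupCStar (Γ : Type*) [Group Γ] : Type _ := (maxSeminorm Γ).Completion

namespace GroupCStar

variable {Γ : Type*} [Group Γ]

instance : CStarAlgebra (GroupCStar Γ) := inferInstanceAs (CStarAlgebra (maxSeminorm Γ).Completion)

/-- The canonical map of the group algebra to the group C*-algebra. -/
def of : MonoidAlgebra ℂ Γ →⋆ₐ[ℂ] GroupCStar Γ := (maxSeminorm Γ).of

theorem denseRange_of : DenseRange (of : MonoidAlgebra ℂ Γ → GroupCStar Γ) :=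
  (maxSeminorm Γ).denseRange_of

/-- The canonical unitaries of `C*(Γ)`. -/
def unit : Γ →* GroupCStar Γ where
  toFun g := of (MonoidAlgebra.single g 1)
  map_one' := map_one of
  map_mul' g h := by rw [← map_mul, MonoidAlgebra.single_mul_single, one_mul]

theorem unit_apply (g : Γ) : unit g = of (MonoidAlgebra.single g 1) := rfl

theorem unit_inv (g : Γ) : unit g⁻¹ = star (unit g) := by
  rw [unit_apply, unit_apply, ← map_star, GroupAlgebra.star_single, star_one]

/-- The universal property of `C*(Γ)`: extension of a unitary representation. -/
def lift {C : Type*} [CStarAlgebra C] (u : Γ →* C) (hu : ∀ g, u g⁻¹ = star (u g)) :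
    GroupCStar Γ →⋆ₐ[ℂ] C :=
  CStarSeminorm.lift (p := maxSeminorm Γ) (GroupAlgebra.starLift u hu) fun x =>
    CStarSeminorm.le_sup Set.univ GroupAlgebra.seminorm_bounded
      (CStarSeminorm.ofHom (GroupAlgebra.starLift u hu)) (Set.mem_univ _) x

@[simp] theorem lift_unit {C : Type*} [CStarAlgebra C] (u : Γ →* C)
    (hu : ∀ g, u g⁻¹ = star (u g)) (g : Γ) : lift u hu (unit g) = u g :=
  (CStarSeminorm.lift_of (p := maxSeminorm Γ) (GroupAlgebra.starLift u hu) _ _).trans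
    (GroupAlgebra.starLift_single u hu g)

theorem of_mem_span (x : MonoidAlgebra ℂ Γ) :
    of x ∈ Submodule.span ℂ (Set.range (unit : Γ → GroupCStar Γ)) := by
  induction x using MonoidAlgebra.induction_linear with
  | zero => rw [map_zero]; exact zero_mem _
  | add a b ha hb => rw [map_add]; exact add_mem ha hb
  | single g c =>
    have h : (MonoidAlgebra.single g c : MonoidAlgebra ℂ Γ) = c • MonoidAlgebra.single g 1 := by
      rw [MonoidAlgebra.smul_single, smul_eq_mul, mul_one]
    rw [h, map_smul]
    exact Submodule.smul_mem _ _ (Submodule.subset_span ⟨g, rfl⟩)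

theorem dense_span : (Submodule.span ℂ
    (Set.range (unit : Γ → GroupCStar Γ))).topologicalClosure = ⊤ := by
  refine Submodule.dense_iff_topologicalClosure_eq_top.mp (denseRange_of.mono ?_)
  rintro _ ⟨x, rfl⟩
  exact of_mem_span x

theorem hom_ext {C : Type*} [CStarAlgebra C] {F G : GroupCStar Γ →⋆ₐ[ℂ] C}
    (h : ∀ g, F (unit g) = G (unit g)) : F = G :=
  CStarSeminorm.hom_ext (p := maxSeminorm Γ) fun x => by
    change F (of x) = G (of x)
    refine Submodule.span_induction (p := fun y _ => F y = G y) ?_ ?_ ?_ ?_ (of_mem_span x)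
    · rintro _ ⟨g, rfl⟩; exact h g
    · rw [map_zero, map_zero]
    · intro x y _ _ hx hy; rw [map_add, map_add, hx, hy]
    · intro c x _ hx; rw [map_smul, map_smul, hx]

end GroupCStar


/-! ### Compact quantum groups, free actions and equivariant joins -/

/-- A compact quantum group structure on the unital C*-algebra `H`: a coassociative unital
star-homomorphism `Δ : H → H ⊗ H` (minimal tensor product) such that the linear spans of
`Δ(H)(1 ⊗ H)` and of `Δ(H)(H ⊗ 1)` are dense. -/
structure CompactQuantumGroup (H : Type u) [CStarAlgebra H] where
  /-- The comultiplication. -/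
  comul : H →⋆ₐ[ℂ] MinTensor.{w} H H
  coassoc : ∀ h : H,
    MinTensor.assocL.{w} H H H (MinTensor.map.{w} comul (StarAlgHom.id ℂ H) (comul h)) =
      MinTensor.assocR.{w} H H H (MinTensor.map.{w} (StarAlgHom.id ℂ H) comul (comul h))
  cancel_right : (Submodule.span ℂ
    {z | ∃ a b : H, z = comul a * MinTensor.inr.{w} b}).topologicalClosure = ⊤
  cancel_left : (Submodule.span ℂ
    {z | ∃ a b : H, z = comul a * MinTensor.inl.{w} b}).topologicalClosure = ⊤

namespace GroupCStar

variable {Γ : Type u} [Group Γ]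

theorem star_tmul {A : Type*} {B : Type*} [CStarAlgebra A] [CStarAlgebra B] (a : A) (b : B) :
    star (MinTensor.tmul.{w} a b) = MinTensor.tmul.{w} (star a) (star b) := by
  rw [MinTensor.tmul, ← map_star, TensorProduct.star_tmul]
  rfl

/-- The diagonal representation `γ ↦ γ ⊗ γ`. -/
def diag : Γ →* MinTensor.{w} (GroupCStar Γ) (GroupCStar Γ) where
  toFun g := MinTensor.tmul.{w} (unit g) (unit g)
  map_one' := by
    rw [map_one]
    exact map_one (MinTensor.of.{w} (GroupCStar Γ) (GroupCStar Γ))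
  map_mul' g h := by rw [map_mul, MinTensor.tmul_mul_tmul]

/-- The comultiplication of `C*(Γ)`, determined by `Δ(γ) = γ ⊗ γ`. -/
def comul : GroupCStar Γ →⋆ₐ[ℂ] MinTensor.{w} (GroupCStar Γ) (GroupCStar Γ) :=
  lift diag.{w} fun g => by
    change MinTensor.tmul.{w} (unit g⁻¹) (unit g⁻¹) = star (MinTensor.tmul.{w} (unit g) (unit g))
    rw [star_tmul, unit_inv]

theorem comul_unit (g : Γ) : comul.{w} (unit g) = MinTensor.tmul.{w} (unit g) (unit g) :=
  lift_unit diag.{w} _ g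

theorem eq_top_of_tmul (M : Submodule ℂ (MinTensor.{w} (GroupCStar Γ) (GroupCStar Γ)))
    (hM : IsClosed (M : Set (MinTensor.{w} (GroupCStar Γ) (GroupCStar Γ))))
    (h : ∀ g k : Γ, MinTensor.tmul.{w} (unit g) (unit k) ∈ M) : M = ⊤ := by
  have dense : ∀ (F : GroupCStar Γ →ₗ[ℂ] MinTensor.{w} (GroupCStar Γ) (GroupCStar Γ)),
      Continuous F → (∀ g : Γ, F (unit g) ∈ M) → ∀ y, F y ∈ M := by
    intro F hF hg y
    have hle : (Submodule.span ℂ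
        (Set.range (unit : Γ → GroupCStar Γ))).topologicalClosure ≤ M.comap F := by
      refine Submodule.topologicalClosure_minimal _ ?_ (hM.preimage hF)
      rw [Submodule.span_le]
      rintro _ ⟨g, rfl⟩
      exact hg g
    rw [dense_span] at hle
    exact hle (Submodule.mem_top (x := y))
  have h1 : ∀ (a : GroupCStar Γ) (k : Γ), MinTensor.tmul.{w} a (unit k) ∈ M := fun a k => by
    have := dense ((LinearMap.mulRight ℂ (MinTensor.inr.{w} (unit k))).comp
      (MinTensor.inl.{w} : GroupCStar Γ →⋆ₐ[ℂ] _).toAlgHom.toLinearMap)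
      ((continuous_starHom (MinTensor.inl.{w})).mul continuous_const)
      (fun g => by
        change MinTensor.inl.{w} (unit g) * MinTensor.inr.{w} (unit k) ∈ M
        rw [MinTensor.inl_mul_inr]; exact h g k) a
    change MinTensor.inl.{w} a * MinTensor.inr.{w} (unit k) ∈ M at this
    rwa [MinTensor.inl_mul_inr] at this
  have h2 : ∀ a b : GroupCStar Γ, MinTensor.tmul.{w} a b ∈ M := fun a b => by
    have := dense ((LinearMap.mulLeft ℂ (MinTensor.inl.{w} a)).comp
      (MinTensor.inr.{w} : GroupCStar Γ →⋆ₐ[ℂ] _).toAlgHom.toLinearMap)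
      (continuous_const.mul (continuous_starHom (MinTensor.inr.{w})))
      (fun g => by
        change MinTensor.inl.{w} a * MinTensor.inr.{w} (unit g) ∈ M
        rw [MinTensor.inl_mul_inr]; exact h1 a g) b
    change MinTensor.inl.{w} a * MinTensor.inr.{w} b ∈ M at this
    rwa [MinTensor.inl_mul_inr] at this
  rw [eq_top_iff]
  rintro z -
  refine MinTensor.induction (P := fun z => z ∈ M) hM (fun x => ?_) z
  induction x with
  | zero => rw [map_zero]; exact zero_mem _
  | add a b ha hb => rw [map_add]; exact add_mem ha hb
  | tmul a b => exact h2 a b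

/-- The compact quantum group `C*(Γ)`, with comultiplication `Δ(γ) = γ ⊗ γ`. -/
def quantumGroup (Γ : Type u) [Group Γ] : CompactQuantumGroup.{w} (GroupCStar Γ) where
  comul := comul.{w}
  coassoc h := by
    have : ((MinTensor.assocL.{w} _ _ _).comp
        (MinTensor.map.{w} comul.{w} (StarAlgHom.id ℂ (GroupCStar Γ)))).comp comul.{w} =
        ((MinTensor.assocR.{w} _ _ _).comp
        (MinTensor.map.{w} (StarAlgHom.id ℂ (GroupCStar Γ)) comul.{w})).comp comul.{w} :=
      hom_ext fun g => by
        simp only [StarAlgHom.comp_apply, comul_unit, MinTensor.map_tmul, StarAlgHom.coe_id, id_eq,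
          MinTensor.assocL_tmul, MinTensor.assocR_tmul]
    exact DFunLike.congr_fun this h
  cancel_right := by
    refine eq_top_of_tmul _ (Submodule.isClosed_topologicalClosure _) fun g k => ?_
    refine Submodule.le_topologicalClosure _ (Submodule.subset_span
      ⟨unit g, unit (g⁻¹ * k), ?_⟩)
    rw [comul_unit, ← MinTensor.inl_mul_inr, ← MinTensor.inl_mul_inr, mul_assoc, ← map_mul,
      ← map_mul, mul_inv_cancel_left]
  cancel_left := by
    refine eq_top_of_tmul _ (Submodule.isClosed_topologicalClosure _) fun g k => ?_
    refine Submodule.le_topologicalClosure _ (Submodule.subset_span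
      ⟨unit k, unit (k⁻¹ * g), ?_⟩)
    rw [comul_unit, ← MinTensor.inl_mul_inr, (MinTensor.commute_inl_inr _ _).eq,
      ← MinTensor.inl_mul_inr, (MinTensor.commute_inl_inr _ _).eq, mul_assoc, ← map_mul,
      ← map_mul, mul_inv_cancel_left]

end GroupCStar

section Coaction

variable {H : Type u} [CStarAlgebra H]

/-- A coaction (an action of the compact quantum group) on the unital C*-algebra `A`: an injective
unital star-homomorphism `δ : A → A ⊗ H` with `(δ ⊗ id) δ = (id ⊗ Δ) δ` such that the linear span
of `δ(A)(1 ⊗ H)` is dense. -/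
structure Coaction (Q : CompactQuantumGroup.{w} H) (A : Type v) [CStarAlgebra A] where
  /-- The underlying star-homomorphism `δ : A → A ⊗ H`. -/
  hom : A →⋆ₐ[ℂ] MinTensor.{w} A H
  injective : Function.Injective hom
  coassoc : ∀ a : A,
    MinTensor.assocL.{w} A H H (MinTensor.map.{w} hom (StarAlgHom.id ℂ H) (hom a)) =
      MinTensor.assocR.{w} A H H (MinTensor.map.{w} (StarAlgHom.id ℂ A) Q.comul (hom a))
  dense : (Submodule.span ℂ
    {z | ∃ (a : A) (h : H), z = hom a * MinTensor.inr.{w} h}).topologicalClosure = ⊤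

/-- Evaluation at a point `t` of `[0,1]`. -/
def evalHom (D : Type v) [CStarAlgebra D] (t : unitInterval) : C(unitInterval, D) →⋆ₐ[ℂ] D where
  toFun f := f t
  map_one' := rfl
  map_mul' _ _ := rfl
  map_zero' := rfl
  map_add' _ _ := rfl
  commutes' _ := rfl
  map_star' _ := rfl

namespace Coaction

variable {Q : CompactQuantumGroup.{w} H} {A : Type v} [CStarAlgebra A] (δ : Coaction Q A)

/-- The coaction is free: the linear span of `(A ⊗ 1) δ(A)` is dense in `A ⊗ H`. -/
def IsFree : Prop :=
  (Submodule.span ℂ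
    {z | ∃ a b : A, z = MinTensor.inl.{w} a * δ.hom b}).topologicalClosure = ⊤

/-- The equivariant join: continuous functions `f : [0,1] → A ⊗ H` with
`f 0 ∈ ℂ ⊗ H` and `f 1 ∈ δ(A)`. -/
def join : StarSubalgebra ℂ C(unitInterval, MinTensor.{w} A H) :=
  (MinTensor.inr.{w} : H →⋆ₐ[ℂ] MinTensor.{w} A H).range.comap
      (evalHom (MinTensor.{w} A H) 0) ⊓
    δ.hom.range.comap
      (evalHom (MinTensor.{w} A H) 1)

theorem mem_join (f : C(unitInterval, MinTensor.{w} A H)) :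
    f ∈ δ.join ↔ (∃ h : H, MinTensor.inr.{w} h = f 0) ∧ ∃ a : A, δ.hom a = f 1 := Iff.rfl

/-- Evaluation of elements of the join at a point of `[0,1]`. -/
def evalAt (t : unitInterval) : δ.join →⋆ₐ[ℂ] MinTensor.{w} A H :=
  (evalHom (MinTensor.{w} A H) t).comp δ.join.subtype

theorem evalAt_apply (t : unitInterval) (f : δ.join) : δ.evalAt t f = f.1 t := rfl

/-- A star-homomorphism `ψ : H → A ⊛ H` is equivariant if it intertwines `Δ` with the coaction
`δ_Δ` on the join that applies `id ⊗ Δ` at every point `t` of `[0,1]`; in other words,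
`(id ⊗ Δ)(ψ(h)(t)) = ((ev_t ∘ ψ) ⊗ id)(Δ h)` for all `h` and `t`. -/
def IsEquivariant (ψ : H →⋆ₐ[ℂ] δ.join) : Prop :=
  ∀ (h : H) (t : unitInterval),
    MinTensor.assocR.{w} A H H
        (MinTensor.map.{w} (StarAlgHom.id ℂ A) Q.comul (δ.evalAt t (ψ h))) =
      MinTensor.assocL.{w} A H H
        (MinTensor.map.{w} ((δ.evalAt t).comp ψ) (StarAlgHom.id ℂ H) (Q.comul h))

end Coaction

/-- The Type 2 noncommutative Borsuk-Ulam property of a compact quantum group `(H, Δ)`: for every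
non-zero unital C*-algebra `A` with a free coaction `δ` of `(H, Δ)`, there is no equivariant unital
star-homomorphism from `H` to the equivariant join of `A` and `H`. -/
def TypeTwoHolds {H : Type u} [CStarAlgebra H] (Q : CompactQuantumGroup.{w} H) : Prop :=
  ∀ (A : Type w) [CStarAlgebra A] [Nontrivial A] (δ : Coaction Q A), δ.IsFree →
    ¬ ∃ ψ : H →⋆ₐ[ℂ] δ.join, δ.IsEquivariant ψ

end Coaction


/-! ### Hyperbolic matrices and their semidirect products -/

/-- An integer matrix of determinant one is hyperbolic if none of its complex eigenvalues has
absolute value one. -/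
def IsHyperbolic {n : ℕ} (σ : Matrix.SpecialLinearGroup (Fin n) ℤ) : Prop :=
  ∀ μ : ℂ, Module.End.HasEigenvalue
    (Matrix.toLin' ((σ : Matrix (Fin n) (Fin n) ℤ).map (Int.cast : ℤ → ℂ))) μ → ‖μ‖ ≠ 1

/-- The automorphism `m ↦ σᵀ m` of `ℤⁿ` that `σ` induces on the Pontryagin dual `ℤⁿ` of the torus
`𝕋ⁿ = ℝⁿ/ℤⁿ`: the character with exponent `m`, composed with `σ`, has exponent `σᵀ m`. -/
def dualAut {n : ℕ} (σ : Matrix.SpecialLinearGroup (Fin n) ℤ) :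
    MulAut (Multiplicative (Fin n → ℤ)) :=
  AddEquiv.toMultiplicative (Matrix.SpecialLinearGroup.toLin' σ.transpose).toAddEquiv

theorem dualAut_apply {n : ℕ} (σ : Matrix.SpecialLinearGroup (Fin n) ℤ)
    (m : Multiplicative (Fin n → ℤ)) : dualAut σ m =
      Multiplicative.ofAdd
        ((σ : Matrix (Fin n) (Fin n) ℤ).transpose.mulVec (Multiplicative.toAdd m)) := rfl

/-- The semidirect product `ℤⁿ ⋊ ℤ` in which the generator of `ℤ` acts on `ℤⁿ` by the automorphism
dual to `σ`. -/
abbrev HyperbolicGroup {n : ℕ} (σ : Matrix.SpecialLinearGroup (Fin n) ℤ) : Type :=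
  Multiplicative (Fin n → ℤ) ⋊[zpowersHom (MulAut (Multiplicative (Fin n → ℤ))) (dualAut σ)]
    Multiplicative ℤ

/-- A discrete group is amenable if it has a left-invariant finitely additive probability measure
on all of its subsets. -/
def IsAmenableGroup (Γ : Type*) [Group Γ] : Prop :=
  ∃ μ : Set Γ → ℝ, (∀ S, 0 ≤ μ S) ∧ μ Set.univ = 1 ∧
    (∀ S T, Disjoint S T → μ (S ∪ T) = μ S + μ T) ∧
    ∀ (g : Γ) (S : Set Γ), μ ((fun x => g * x) '' S) = μ S

/-- A group is torsion-free if no element other than the identity has finite order. -/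
def IsTorsionFreeGroup (Γ : Type*) [Group Γ] : Prop :=
  ∀ g : Γ, g ≠ 1 → ¬ IsOfFinOrder g

/-- A group is non-abelian if two of its elements do not commute. -/
def IsNonabelianGroup (Γ : Type*) [Group Γ] : Prop :=
  ∃ a b : Γ, a * b ≠ b * a

end

universe w

open scoped TensorProduct InnerProductSpace

noncomputable section

universe u v

/-! ### Spectral obstruction: eigenvalues of linear isometries -/

section LinearIsometry

/-! The group-theoretic claims are elementary. Torsion-freeness passes to the extension of `ℤ` by
`ℤⁿ`, commutativity would force `σ = 1` and hence the eigenvalue `1`, and invariant means pass to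
extensions (`IsInvariantMean.extension`). The substance is Type 2.

Suppose `ψ` is an equivariant homomorphism into the join. Evaluating at `t` and applying `id ⊗ ε`,
with `ε` the counit, turns `ψ` into a norm-continuous path `u t` of unitary representations of `ℤⁿ ⋊
ℤ`. The boundary condition at `0` makes `u 0` scalar, a character `c`. Dividing the whole path by
`c` gives a path that starts at the trivial representation.

Near the trivial representation there is rigidity on `ℤⁿ` (`IsHyperbolic.rigid`). If the images of
the generators are close to `1`, they have commuting self-adjoint logarithms of small norm. The
image of the generator of `ℤ` conjugates the representation of `ℤⁿ` into its composition with `σᵀ`.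
As the logarithms are too small for any `2π` ambiguity, this conjugation acts on them by the integer
matrix `σᵀ`. Conjugation is isometric, so on the finite-dimensional span of the logarithms its
eigenvalues have modulus one, while they must also be eigenvalues of `σᵀ`. Hyperbolicity leaves only
the zero span (`eq_zero_of_isometry_matrix`). Hence the set of times at which the twisted path is
trivial on `ℤⁿ` is clopen, and it is all of `[0,1]` (`IsHyperbolic.path_constant`).

At `t = 1` take a lattice generator `e ≠ 1` and put `z = ψ(e)(1)`. Equivariance gives `(id ⊗ Δ)(z) =
z ⊗ e`, and applying the counit to the middle leg recovers `z` from its slice: `z = c(e) (1 ⊗ e)`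
(`GroupCStar.eq_smul_inr_of_slice`). The boundary condition at `1` says that `z` lies in the image
of the coaction. Coassociativity would then give `1 ⊗ 1 ⊗ e = 1 ⊗ e ⊗ e`, which the regular
representation refutes (`Coaction.hom_ne_smul_inr`). -/

theorem Module.End.aeval_comp_of_comp_eq {K V W : Type*} [Field K] [AddCommGroup V] [Module K V]
    [AddCommGroup W] [Module K W] (f : V →ₗ[K] W) (S : Module.End K V) (T : Module.End K W)
    (h : ∀ x, T (f x) = f (S x)) (p : Polynomial K) (x : V) :
    Polynomial.aeval T p (f x) = f (Polynomial.aeval S p x) := by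
  induction p using Polynomial.induction_on generalizing x with
  | C a => simp [Module.algebraMap_end_apply]
  | add p q hp hq => simp [hp, hq]
  | monomial k a ih =>
    rw [pow_succ, ← mul_assoc, map_mul _ _ Polynomial.X, map_mul _ _ Polynomial.X,
      Polynomial.aeval_X, Polynomial.aeval_X, Module.End.mul_apply, Module.End.mul_apply, h, ih]

/-- A matrix without eigenvalues of modulus one is not a quotient of a linear isometry. -/
theorem eq_zero_of_isometry_matrix {n : ℕ} {D : Type*} [NormedAddCommGroup D] [NormedSpace ℂ D]
    (M : Matrix (Fin n) (Fin n) ℂ)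
    (hM : ∀ μ : ℂ, M.charpoly.IsRoot μ → ‖μ‖ ≠ 1)
    (T : D →ₗ[ℂ] D) (hT : ∀ x, ‖T x‖ = ‖x‖) (a : Fin n → D)
    (ha : ∀ i, T (a i) = ∑ j, M j i • a j) : a = 0 := by
  set f : (Fin n → ℂ) →ₗ[ℂ] D := Fintype.linearCombination ℂ a with hf
  have hfe : ∀ i, f (Pi.single i 1) = a i := fun i => by
    simp [hf]
  have hcomm : ∀ c, T (f c) = f (Matrix.toLin' M c) := by
    intro c
    have : T ∘ₗ f = f ∘ₗ Matrix.toLin' M := by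
      refine LinearMap.pi_ext' fun i => LinearMap.ext_ring ?_
      simp only [LinearMap.comp_apply, LinearMap.single_apply, hfe, ha, Matrix.toLin'_apply,
        Matrix.mulVec_single_one]
      simp [hf, Fintype.linearCombination_apply]
    exact LinearMap.congr_fun this c
  by_contra hne
  have hV : ∀ x ∈ LinearMap.range f, T x ∈ LinearMap.range f := by
    rintro _ ⟨c, rfl⟩
    exact ⟨_, (hcomm c).symm⟩
  have hnt : Nontrivial (LinearMap.range f) := by
    obtain ⟨i, hi⟩ := Function.ne_iff.mp hne
    exact ⟨⟨⟨a i, Pi.single i 1, hfe i⟩, 0, fun h => hi (congrArg Subtype.val h)⟩⟩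
  -- `D` may be infinite-dimensional, but the range of `f` is finite-dimensional, `T`-invariant and,
  -- as `a ≠ 0`, non-zero.
  obtain ⟨μ, hμ⟩ := Module.End.exists_eigenvalue (T.restrict hV)
  obtain ⟨⟨v, c, hc⟩, hv⟩ := hμ.exists_hasEigenvector
  have hTv : T v = μ • v := congrArg Subtype.val hv.apply_eq_smul
  have hv0 : v ≠ 0 := fun h => hv.2 (Subtype.ext h)
  have hev : Module.End.HasEigenvector (T : Module.End ℂ D) μ v :=
    ⟨Module.End.mem_eigenspace_iff.mpr hTv, hv0⟩
  refine hM μ ?_ ?_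
  -- With `p` the characteristic polynomial of `M`, the vector `p(T) v` is `p(μ) v`; it is also `f
  -- (p(M) c) = 0` by Cayley–Hamilton, so `p(μ) = 0`.
  · have h1 := Module.End.aeval_apply_of_hasEigenvector (p := M.charpoly) hev
    rw [← hc, Module.End.aeval_comp_of_comp_eq f (Matrix.toLin' M) T hcomm] at h1
    have h2 : Polynomial.aeval (Matrix.toLin' M) M.charpoly = 0 := by
      have := LinearMap.aeval_self_charpoly (Matrix.toLin' M)
      rwa [Matrix.charpoly_toLin'] at this
    rw [h2, LinearMap.zero_apply, map_zero, hc] at h1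
    exact (smul_eq_zero.mp h1.symm).resolve_right hv0
  · have h1 := hT v
    rw [hTv, norm_smul] at h1
    exact mul_right_cancel₀ (norm_ne_zero_iff.mpr hv0) (h1.trans (one_mul _).symm)

/-- A matrix and its transpose have the same characteristic polynomial, so hyperbolicity of `σ`
controls the dual action as well. -/
theorem IsHyperbolic.norm_ne_one_of_isRoot_transpose {n : ℕ}
    {σ : Matrix.SpecialLinearGroup (Fin n) ℤ} (hσ : IsHyperbolic σ) (μ : ℂ)
    (h : (((σ : Matrix (Fin n) (Fin n) ℤ).transpose.map (Int.cast : ℤ → ℂ))).charpoly.IsRoot μ) :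
    ‖μ‖ ≠ 1 := by
  refine hσ μ ?_
  rw [Module.End.hasEigenvalue_iff_isRoot_charpoly, Matrix.charpoly_toLin',
    ← Matrix.charpoly_transpose]
  exact h

end LinearIsometry

/-! ### Logarithms of unitaries and rigidity near the trivial representation -/

section Rigidity

open selfAdjoint Unitary

variable {D : Type*} [CStarAlgebra D]

/-- For `‖u - 1‖ < 2` the norm of the logarithm is `arccos (1 - ‖u - 1‖² / 2)`, which is continuous
at `‖u - 1‖ = 0` with value `0`. The bound `2` keeps the spectrum away from the branch cut at `-1`.
-/
theorem Unitary.norm_argSelfAdjoint_lt {η : ℝ} (hη : 0 < η) :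
    ∃ ε > 0, ∀ u : unitary D, ‖(u : D) - 1‖ < ε → ‖(u : D) - 1‖ < 2 ∧ ‖argSelfAdjoint u‖ < η := by
  have hc : ContinuousAt (fun x : ℝ => Real.arccos (1 - x ^ 2 / 2)) 0 := by fun_prop
  have h := Metric.continuousAt_iff.mp hc η hη
  obtain ⟨δ, hδ, h⟩ := h
  refine ⟨min δ 2, by positivity, fun u hu => ?_⟩
  have hu2 := hu.trans_le (min_le_right _ _)
  refine ⟨hu2, ?_⟩
  have := h (x := ‖(u : D) - 1‖) (by simpa using hu.trans_le (min_le_left _ _))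
  rw [norm_argSelfAdjoint hu2]
  simp only [Real.dist_eq] at this
  simpa using (le_abs_self _).trans_lt this

theorem Unitary.commute_argSelfAdjoint {u v : unitary D} (h : Commute u v) :
    Commute (argSelfAdjoint u : D) (argSelfAdjoint v : D) := by
  -- Functional calculus of a normal element preserves commutation only with what commutes with both
  -- the element and its adjoint; for unitaries the adjoint is the inverse. The argument is run once
  -- in each variable.
  have key : ∀ u v : unitary D, Commute u v → Commute (argSelfAdjoint u : D) (v : D) :=
    fun u v h => Commute.cfc (congrArg Subtype.val h.eq)
      (congrArg Subtype.val (h.inv_left).eq) _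
  have h1 : Commute (argSelfAdjoint u : D) ((star v : unitary D) : D) := key u v⁻¹ h.inv_right
  exact (Commute.cfc (key u v h).symm h1.symm _).symm

/-- A unitary representation of `ℤⁿ` whose generators are close to `1` is the exponential of its
logarithm. -/
theorem eq_expUnitary_sum {n : ℕ} (v : Multiplicative (Fin n → ℤ) →* unitary D)
    (hv : ∀ i, ‖(v (.ofAdd (Pi.single i 1)) : D) - 1‖ < 2) (m : Fin n → ℤ) :
    v (.ofAdd m) = expUnitary (∑ j, m j • argSelfAdjoint (v (.ofAdd (Pi.single j 1)))) := by
  set a : Fin n → selfAdjoint D := fun j => argSelfAdjoint (v (.ofAdd (Pi.single j 1))) with ha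
  have hcomm : ∀ i j, Commute (a i : D) (a j : D) := fun i j =>
    Unitary.commute_argSelfAdjoint ((Commute.all _ _).map v)
  -- The logarithms commute, so the exponential of their integer combinations is multiplicative; two
  -- homomorphisms on `ℤⁿ` that agree on the generators are equal.
  let E : Multiplicative (Fin n → ℤ) →* unitary D :=
    { toFun := fun m => expUnitary (∑ j, m.toAdd j • a j)
      map_one' := by simp
      map_mul' := fun m m' => by
        rw [← Commute.expUnitary_add]
        · simp [add_smul, Finset.sum_add_distrib]
        · simp only [AddSubgroup.val_finsetSum, AddSubgroupClass.coe_zsmul]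
          exact Commute.sum_left _ _ _ fun i _ => Commute.sum_right _ _ _ fun j _ =>
            ((hcomm i j).smul_left _).smul_right _ }
  have hE : ∀ i, v (.ofAdd (Pi.single i 1)) = E (.ofAdd (Pi.single i 1)) := fun i => by
    change _ = expUnitary (∑ j, (Pi.single i 1 : Fin n → ℤ) j • a j)
    rw [Finset.sum_eq_single i (fun j _ hj => by simp [hj]) (by simp), Pi.single_eq_same, one_smul]
    exact (expUnitary_argSelfAdjoint (hv i)).symm
  change v (.ofAdd m) = E (.ofAdd m)
  rw [← Finset.univ_sum_single m]
  refine Finset.sum_induction _ (fun m => v (.ofAdd m) = E (.ofAdd m)) (fun m m' h h' => ?_)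
    ?_ fun i _ => ?_
  · rw [ofAdd_add, map_mul, map_mul, h, h']
  · rw [ofAdd_zero, map_one, map_one]
  · have : (Pi.single i (m i) : Fin n → ℤ) = m i • Pi.single i 1 := by
      rw [← Pi.single_smul]; simp
    rw [this, ofAdd_zsmul, map_zpow, map_zpow, hE]

/-- The logarithm is a continuous functional calculus, because `arg` is continuous on the spectrum
of a unitary at distance less than `2` from `1`, and star-automorphisms commute with functional
calculus. -/
theorem Unitary.argSelfAdjoint_conj (U v : unitary D) (hv : ‖(v : D) - 1‖ < 2) :
    (argSelfAdjoint (U * v * U⁻¹) : D) =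
      Unitary.conjStarAlgAut ℂ D U (argSelfAdjoint v : D) := by
  have hc : ContinuousOn (fun z : ℂ => (Complex.arg z : ℂ)) (spectrum ℂ (v : D)) := fun z hz =>
    (Complex.continuous_ofReal.continuousAt.comp (Complex.continuousAt_arg
      ((spectrum_subset_slitPlane_iff_norm_lt_two v.2).mpr hv hz))).continuousWithinAt
  have hφ : Continuous (Unitary.conjStarAlgAut ℂ D U) := by
    change Continuous fun x : D => (U : D) * x * star (U : D)
    fun_prop
  have hn : IsStarNormal (Unitary.conjStarAlgAut ℂ D U (v : D)) := by
    change IsStarNormal (((U * v * U⁻¹ : unitary D)) : D)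
    infer_instance
  exact (StarAlgHomClass.map_cfc (Unitary.conjStarAlgAut ℂ D U)
    (fun z : ℂ => (Complex.arg z : ℂ)) (v : D) hc hφ (inferInstance : IsStarNormal (v : D)) hn).symm

/-- Rigidity of the trivial representation: if the unitary representation `v` of `ℤⁿ` is
equivalent to its composition with a hyperbolic automorphism and is close to `1` on the
generators, then it is trivial on the generators. -/
theorem IsHyperbolic.rigid {n : ℕ} {σ : Matrix.SpecialLinearGroup (Fin n) ℤ} (hσ : IsHyperbolic σ)
    (D : Type*) [CStarAlgebra D] :
    ∃ ε > 0, ∀ (v : Multiplicative (Fin n → ℤ) →* unitary D) (U : unitary D),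
      (∀ m, U * v m * U⁻¹ = v (dualAut σ m)) →
      (∀ i, ‖(v (.ofAdd (Pi.single i 1)) : D) - 1‖ < ε) →
      ∀ i, v (.ofAdd (Pi.single i 1)) = 1 := by
  set N : Matrix (Fin n) (Fin n) ℤ := (σ : Matrix (Fin n) (Fin n) ℤ).transpose with hN
  set C : ℝ := ∑ i, ∑ j, ‖N j i‖ with hC
  have hC0 : 0 ≤ C := by positivity
  -- With logarithms bounded by `π / (1 + C)`, every combination taken from a column of `N` has norm
  -- at most `C π / (1 + C) < π`, the range in which the logarithm inverts the exponential. This `ε`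
  -- depends on `σ` and `D` but not on the representation.
  obtain ⟨ε, hε, h⟩ := Unitary.norm_argSelfAdjoint_lt (D := D)
    (η := Real.pi / (1 + C)) (by positivity)
  refine ⟨ε, hε, fun v U hU hv => ?_⟩
  have hv2 : ∀ i, ‖(v (.ofAdd (Pi.single i 1)) : D) - 1‖ < 2 := fun i => (h _ (hv i)).1
  set a : Fin n → selfAdjoint D := fun j => argSelfAdjoint (v (.ofAdd (Pi.single j 1))) with ha
  have haη : ∀ j, ‖a j‖ ≤ Real.pi / (1 + C) := fun j => (h _ (hv j)).2.le
  have hconj : ∀ i, Unitary.conjStarAlgAut ℂ D U (a i : D) = ∑ j, (N j i : ℂ) • (a j : D) := by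
    intro i
    -- The image of the `i`-th generator under the dual automorphism is the `i`-th column of `N`.
    have h1 : argSelfAdjoint (v (dualAut σ (.ofAdd (Pi.single i 1)))) = ∑ j, N j i • a j := by
      rw [dualAut_apply, toAdd_ofAdd, Matrix.mulVec_single_one, eq_expUnitary_sum v hv2]
      refine argSelfAdjoint_expUnitary ?_
      refine (norm_sum_le _ _).trans_lt ?_
      calc ∑ j, ‖N j i • a j‖ ≤ ∑ j, ‖N j i‖ * (Real.pi / (1 + C)) := by
            gcongr with j
            refine (norm_zsmul_le _ _).trans ?_
            exact mul_le_mul_of_nonneg_left (haη j) (norm_nonneg _)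
        _ ≤ C * (Real.pi / (1 + C)) := by
            rw [← Finset.sum_mul]
            gcongr
            exact Finset.single_le_sum (f := fun i => ∑ j, ‖N j i‖)
              (fun i _ => by positivity) (Finset.mem_univ i)
        _ < Real.pi := by
            rw [mul_div_assoc', div_lt_iff₀ (by positivity)]
            nlinarith [Real.pi_pos]
    rw [← Unitary.argSelfAdjoint_conj _ _ (hv2 i), hU, h1]
    simp [Algebra.smul_def]
  -- Conjugation by `U` is an isometry whose action on the logarithms is given by `N`, so the
  -- spectral obstruction kills them all.
  have h0 := eq_zero_of_isometry_matrix (N.map (Int.cast : ℤ → ℂ))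
    (fun μ => hσ.norm_ne_one_of_isRoot_transpose μ)
    (Unitary.conjStarAlgAut ℂ D U).toAlgEquiv.toLinearMap
    (fun x => (CStarRing.norm_mul_coe_unitary _ (star U)).trans (CStarRing.norm_coe_unitary_mul U x))
    (fun i => (a i : D)) hconj
  intro i
  have h1 : a i = 0 := Subtype.ext (congrFun h0 i)
  rw [← expUnitary_argSelfAdjoint (hv2 i)]
  exact (congrArg expUnitary h1).trans expUnitary_zero

end Rigidity

/-! ### The left regular representation -/

section RegularRepresentation

open ContinuousLinearMap

/-- Permutation of the coordinates of an `ℓ²`-space. -/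
def lpReindex {ι : Type*} (e : Equiv.Perm ι) :
    lp (fun _ : ι => ℂ) 2 →ₗᵢ[ℂ] lp (fun _ : ι => ℂ) 2 where
  toFun f := ⟨fun i => f (e.symm i), memℓp_gen <| by
    have := (lp.memℓp f).summable (by norm_num)
    exact (e.symm.summable_iff (f := fun i => ‖f i‖ ^ (2 : ENNReal).toReal)).mpr this⟩
  map_add' _ _ := rfl
  map_smul' _ _ := rfl
  norm_map' f := by
    rw [lp.norm_eq_tsum_rpow (by norm_num), lp.norm_eq_tsum_rpow (by norm_num)]
    congr 1
    exact e.symm.tsum_eq (fun i => ‖f i‖ ^ (2 : ENNReal).toReal)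

variable (Γ : Type v) [Group Γ]

/-- The Hilbert space `ℓ²(Γ)`, in a prescribed universe. -/
abbrev EllTwo : Type (max v w) := lp (fun _ : ULift.{w} Γ => ℂ) 2

variable {Γ}

/-- Left translation on (a lift of) `Γ`. -/
def leftTranslation : Γ →* Equiv.Perm (ULift.{w} Γ) := MulAction.toPermHom Γ (ULift.{w} Γ)

/-- The left regular representation of `Γ`. -/
def leftRegular : Γ →* (EllTwo.{w} Γ →L[ℂ] EllTwo.{w} Γ) where
  toFun g := (lpReindex (leftTranslation.{w} g)).toContinuousLinearMap
  map_one' := by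
    rw [map_one]
    rfl
  map_mul' g h := by
    rw [map_mul]
    rfl

theorem leftRegular_apply (g : Γ) (f : EllTwo.{w} Γ) (i : ULift.{w} Γ) :
    leftRegular.{w} g f i = f (g⁻¹ • i) := by
  change f ((leftTranslation.{w} g)⁻¹ i) = _
  rw [← map_inv]
  rfl

theorem leftRegular_inv (g : Γ) : leftRegular.{w} g⁻¹ = star (leftRegular.{w} g) := by
  refine (eq_adjoint_iff _ _).mpr fun x y => ?_
  -- The translation by `g` is isometric; applying it to both entries of the inner product cancels
  -- `g⁻¹`.
  rw [← (lpReindex (leftTranslation.{w} g)).inner_map_map]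
  change ⟪(leftRegular.{w} g * leftRegular.{w} g⁻¹) x, _⟫_ℂ = _
  rw [← map_mul, mul_inv_cancel, map_one]
  rfl

/-- The left regular representation of `C*(Γ)`. -/
def GroupCStar.regularRep : GroupCStar Γ →⋆ₐ[ℂ] (EllTwo.{w} Γ →L[ℂ] EllTwo.{w} Γ) :=
  GroupCStar.lift (C := EllTwo.{w} Γ →L[ℂ] EllTwo.{w} Γ) leftRegular.{w}
    leftRegular_inv

theorem GroupCStar.regularRep_unit (g : Γ) : regularRep.{w} (unit g) = leftRegular.{w} g :=
  lift_unit (C := EllTwo.{w} Γ →L[ℂ] EllTwo.{w} Γ) _ leftRegular_inv g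

open Classical in
/-- The basis vector of `ℓ²(Γ)` at the identity. -/
def vacuum : EllTwo.{w} Γ := lp.single 2 (ULift.up 1) 1

theorem norm_vacuum : ‖(vacuum : EllTwo.{w} Γ)‖ = 1 := by
  classical
  rw [vacuum, lp.norm_single (by norm_num), norm_one]

/-- Distinct group elements give orthogonal basis vectors. This orthogonality is what separates `g`
from `1` in the contradiction ending the proof of Type 2. -/
theorem inner_vacuum_leftRegular {g : Γ} (hg : g ≠ 1) :
    ⟪(vacuum : EllTwo.{w} Γ), leftRegular.{w} g vacuum⟫_ℂ = 0 := by
  classical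
  rw [vacuum, lp.inner_single_left, leftRegular_apply, lp.single_apply_ne, inner_zero_right]
  intro h
  apply hg
  have := congrArg ULift.down h
  simpa using this

end RegularRepresentation

/-! ### The counit, homogeneous elements and the image of a coaction -/

namespace GroupCStar

variable {Γ : Type v} [Group Γ]

/-- The counit of `C*(Γ)`, that is, the trivial representation. -/
def counit : GroupCStar Γ →⋆ₐ[ℂ] ℂ := lift 1 fun _ => by simp

@[simp] theorem counit_unit (g : Γ) : counit (unit g) = 1 := lift_unit _ _ g

/-- The trivial representation of `C*(Γ)` in a C*-algebra. -/
def trivial (B : Type*) [CStarAlgebra B] : GroupCStar Γ →⋆ₐ[ℂ] B :=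
  (StarAlgHom.ofId ℂ B).comp counit

theorem trivial_apply (B : Type*) [CStarAlgebra B] (h : GroupCStar Γ) :
    trivial B h = algebraMap ℂ B (counit h) := rfl

@[simp] theorem trivial_unit (B : Type*) [CStarAlgebra B] (g : Γ) : trivial B (unit g) = 1 := by
  rw [trivial_apply, counit_unit, map_one]

variable {A : Type u} [CStarAlgebra A]

/-- The group elements span a dense subspace of `C*(Γ)`. No closure under scalars is demanded of
`P`, because coefficients can be moved into the arbitrary element `a`. -/
theorem induction_tmul_unit {P : MinTensor.{w} A (GroupCStar Γ) → Prop}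
    (hc : IsClosed {z | P z}) (h0 : P 0) (hadd : ∀ x y, P x → P y → P (x + y))
    (h : ∀ a g, P (MinTensor.tmul.{w} a (unit g))) (z : MinTensor.{w} A (GroupCStar Γ)) : P z := by
  refine MinTensor.induction hc (fun x => ?_) z
  induction x with
  | zero => rwa [map_zero]
  | add x y hx hy => rw [map_add]; exact hadd _ _ hx hy
  | tmul a b =>
    have hcont : Continuous fun b : GroupCStar Γ => MinTensor.tmul.{w} a b := by
      simp only [← MinTensor.inl_mul_inr]
      exact continuous_const.mul (continuous_starHom _)
    change P (MinTensor.tmul.{w} a b)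
    refine CStarSeminorm.induction (maxSeminorm Γ) (P := fun b => P (MinTensor.tmul.{w} a b))
      (hc.preimage hcont) (fun x => ?_) b
    change P (MinTensor.of.{w} A (GroupCStar Γ) (a ⊗ₜ of x))
    induction x using MonoidAlgebra.induction_linear with
    | zero => rwa [map_zero, TensorProduct.tmul_zero, map_zero]
    | add x y hx hy => rw [map_add, TensorProduct.tmul_add, map_add]; exact hadd _ _ hx hy
    | single g c =>
      have hs : (MonoidAlgebra.single g c : MonoidAlgebra ℂ Γ) = c • MonoidAlgebra.single g 1 := by
        rw [MonoidAlgebra.smul_single, smul_eq_mul, mul_one]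
      rw [hs, map_smul, ← TensorProduct.smul_tmul]
      exact h _ _

/-- The star-homomorphism `id ⊗ ε` of `A ⊗ C*(Γ)`, followed by the inclusion of `A`. -/
def slice : MinTensor.{w} A (GroupCStar Γ) →⋆ₐ[ℂ] MinTensor.{w} A (GroupCStar Γ) :=
  MinTensor.map.{w} (StarAlgHom.id ℂ A) (trivial (GroupCStar Γ))

theorem slice_tmul (a : A) (h : GroupCStar Γ) :
    slice (MinTensor.tmul.{w} a h) = MinTensor.tmul.{w} a (trivial (GroupCStar Γ) h) :=
  MinTensor.map_tmul _ _ _ _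

/-- Slicing sends `ℂ ⊗ H` to scalars; the boundary condition of the join at `0` enters through this
fact. -/
theorem slice_inr (h : GroupCStar Γ) :
    slice (MinTensor.inr.{w} h : MinTensor.{w} A (GroupCStar Γ)) =
      algebraMap ℂ _ (counit h) := by
  refine (slice_tmul 1 h).trans ?_
  rw [trivial_apply]
  exact (MinTensor.inr.{w} : GroupCStar Γ →⋆ₐ[ℂ] MinTensor.{w} A _).toAlgHom.commutes _

section Rep

variable {H : Type w} [NormedAddCommGroup H] [InnerProductSpace ℂ H] [CompleteSpace H]
  {K : Type w} [NormedAddCommGroup K] [InnerProductSpace ℂ K] [CompleteSpace K]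
  {L : Type w} [NormedAddCommGroup L] [InnerProductSpace ℂ L] [CompleteSpace L]

open HilbertTensor in
/-- The isometry `y ↦ x ⊗ y` intertwines `π ⊗ τ` with `(π ⊗ ε ⊗ τ)(id ⊗ Δ)`. -/
theorem rep₃_comul (π : A →⋆ₐ[ℂ] (H →L[ℂ] H)) (τ : GroupCStar Γ →⋆ₐ[ℂ] (K →L[ℂ] K)) (x : L)
    (z : MinTensor.{w} A (GroupCStar Γ)) (ξ : HilbertTensor H K) :
    MinTensor.rep₃.{w} π (trivial (L →L[ℂ] L)) τ
      (MinTensor.assocR.{w} _ _ _ (MinTensor.map.{w} (StarAlgHom.id ℂ A) comul.{w} z))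
      (mapL 1 (create K x) ξ) = mapL 1 (create K x) (MinTensor.rep.{w} π τ z ξ) := by
  revert z
  refine induction_tmul_unit ?_ ?_ ?_ ?_
  · have c1 : Continuous fun z : MinTensor.{w} A (GroupCStar Γ) =>
        MinTensor.rep₃.{w} π (trivial (L →L[ℂ] L)) τ (MinTensor.assocR.{w} _ _ _
          (MinTensor.map.{w} (StarAlgHom.id ℂ A) comul.{w} z)) :=
      continuous_starHom (((MinTensor.rep₃.{w} π (trivial (L →L[ℂ] L)) τ).comp
        (MinTensor.assocR.{w} _ _ _)).comp
        (MinTensor.map.{w} (StarAlgHom.id ℂ A) comul.{w}))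
    have c2 : Continuous fun z => MinTensor.rep.{w} π τ z := continuous_starHom _
    exact isClosed_eq (c1.clm_apply continuous_const)
      ((mapL 1 (create K x)).continuous.comp (c2.clm_apply continuous_const))
  · simp
  · intro z z' h h'
    simp only [map_add, add_apply, h, h']
  · intro a g
    rw [MinTensor.map_tmul, comul_unit, MinTensor.assocR_tmul, MinTensor.rep₃_tmul₃,
      MinTensor.rep_tmul, trivial_unit]
    -- Since `Δ(g) = g ⊗ g` and the middle leg acts trivially, this is the counit identity `(ε ⊗ id)
    -- Δ = id` at the level of operators.
    have : mapL (π a) (mapL 1 (τ (unit g))) ∘L mapL 1 (create K x) =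
        mapL 1 (create K x) ∘L mapL (π a) (τ (unit g)) :=
      ext fun y v => by simp
    exact DFunLike.congr_fun this ξ

open HilbertTensor in
-- For a unit vector `x` the map `y ↦ x ⊗ y` is an isometry, so tensoring its adjoint with the
-- identity gives a left inverse.
theorem mapL_one_create_injective {x : L} (hx : ‖x‖ = 1) :
    Function.Injective (mapL (1 : H →L[ℂ] H) (create K x)) := by
  have h1 : ContinuousLinearMap.adjoint (create K x) ∘L create K x = 1 := by
    ext y
    refine ext_inner_left ℂ fun v => ?_
    rw [ContinuousLinearMap.comp_apply, ContinuousLinearMap.adjoint_inner_right, create_apply,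
      create_apply, inner_tmul, inner_self_c, hx]
    simp
  have h2 : mapL (1 : H →L[ℂ] H) (ContinuousLinearMap.adjoint (create K x)) ∘L
      mapL (1 : H →L[ℂ] H) (create K x) = 1 := HilbertTensor.ext fun y v => by
    have := DFunLike.congr_fun h1 v
    rw [ContinuousLinearMap.comp_apply] at this
    rw [ContinuousLinearMap.comp_apply, mapL_tmul, mapL_tmul, this]
    rfl
  exact Function.LeftInverse.injective fun ξ => DFunLike.congr_fun h2 ξ

/-- In a representation `π ⊗ ε ⊗ τ`, the element `z ⊗ h` acts as `(id ⊗ ε)(z) ⊗ h`. -/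
theorem rep₃_assocL_slice (π : A →⋆ₐ[ℂ] (H →L[ℂ] H)) (τ : GroupCStar Γ →⋆ₐ[ℂ] (K →L[ℂ] K))
    (z : MinTensor.{w} A (GroupCStar Γ)) (h : GroupCStar Γ) :
    MinTensor.rep₃.{w} π (trivial (L →L[ℂ] L)) τ
        (MinTensor.assocL.{w} _ _ _ (MinTensor.tmul.{w} (slice z) h)) =
      MinTensor.rep₃.{w} π (trivial (L →L[ℂ] L)) τ
        (MinTensor.assocL.{w} _ _ _ (MinTensor.tmul.{w} z h)) := by
  set F := ((MinTensor.rep₃.{w} π (trivial (L →L[ℂ] L)) τ).comp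
    (MinTensor.assocL.{w} A (GroupCStar Γ) (GroupCStar Γ))).comp MinTensor.inl.{w} with hF
  -- The second leg already acts through the counit, and the counit fixes the scalars that slicing
  -- puts there.
  have hFs : F.comp slice = F := MinTensor.hom_ext
    (D := HilbertTensor H (HilbertTensor L K) →L[ℂ] HilbertTensor H (HilbertTensor L K))
    fun a b => by
      rw [StarAlgHom.comp_apply, slice_tmul]
      change MinTensor.rep₃.{w} π _ τ (MinTensor.assocL.{w} _ _ _
        (MinTensor.tmul.{w} (MinTensor.tmul.{w} _ _) 1)) = MinTensor.rep₃.{w} π _ τ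
        (MinTensor.assocL.{w} _ _ _ (MinTensor.tmul.{w} (MinTensor.tmul.{w} _ _) 1))
      rw [MinTensor.assocL_tmul, MinTensor.assocL_tmul, MinTensor.rep₃_tmul₃,
        MinTensor.rep₃_tmul₃, trivial_apply, trivial_apply, AlgHomClass.commutes, trivial_apply]
      rfl
  rw [← MinTensor.inl_mul_inr, ← MinTensor.inl_mul_inr, map_mul, map_mul, map_mul, map_mul]
  exact congrArg (· * _) (DFunLike.congr_fun hFs z)

/-- An element of `A ⊗ C*(Γ)` which is homogeneous of degree `g` and whose slice by the counit is
the scalar `c` equals `c (1 ⊗ g)`. -/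
theorem eq_smul_inr_of_slice {z : MinTensor.{w} A (GroupCStar Γ)} {g : Γ} {c : ℂ}
    (hz : MinTensor.assocR.{w} _ _ _ (MinTensor.map.{w} (StarAlgHom.id ℂ A) comul.{w} z) =
      MinTensor.assocL.{w} _ _ _ (MinTensor.tmul.{w} z (unit g)))
    (hs : slice z = algebraMap ℂ _ c) : z = c • MinTensor.inr.{w} (unit g) := by
  rw [← sub_eq_zero, ← norm_le_zero_iff]
  refine MinTensor.norm_le_of_forall_rep _ _ le_rfl fun H _ _ _ K _ _ _ π τ => ?_
  rw [norm_le_zero_iff, map_sub, sub_eq_zero]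
  -- A one-dimensional Hilbert space for the middle leg, placed in the universe `w` of the
  -- representations that define the minimal norm.
  obtain ⟨x, hx⟩ : ∃ x : EuclideanSpace ℂ PUnit.{w + 1}, ‖x‖ = 1 :=
    ⟨EuclideanSpace.single PUnit.unit 1, by simp⟩
  -- Both sides act as `c` times `1 ⊗ 1 ⊗ τ(g)`: the left one because the middle leg sees only the
  -- slice of `z`, the right one because `g` in the middle leg acts as `1`. The intertwining
  -- isometry then transfers the equality back to `π ⊗ τ`.
  have key : MinTensor.rep₃.{w} π (trivial (EuclideanSpace ℂ PUnit.{w + 1} →L[ℂ] _)) τ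
      (MinTensor.assocR.{w} _ _ _ (MinTensor.map.{w} (StarAlgHom.id ℂ A) comul.{w} z)) =
      MinTensor.rep₃.{w} π (trivial (EuclideanSpace ℂ PUnit.{w + 1} →L[ℂ] _)) τ
      (MinTensor.assocR.{w} _ _ _ (MinTensor.map.{w} (StarAlgHom.id ℂ A) comul.{w}
        (c • MinTensor.inr.{w} (unit g)))) := by
    rw [hz, ← rep₃_assocL_slice, hs, ← MinTensor.inl_mul_inr, AlgHomClass.commutes,
      ← Algebra.smul_def, map_smul, map_smul, map_smul, map_smul, map_smul]
    congr 1
    change MinTensor.rep₃.{w} π _ τ (MinTensor.assocL.{w} _ _ _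
        (MinTensor.tmul.{w} (MinTensor.tmul.{w} 1 1) (unit g))) = MinTensor.rep₃.{w} π _ τ
        (MinTensor.assocR.{w} _ _ _ (MinTensor.map.{w} _ _ (MinTensor.tmul.{w} 1 (unit g))))
    rw [MinTensor.map_tmul, comul_unit, MinTensor.assocL_tmul, MinTensor.assocR_tmul,
      MinTensor.rep₃_tmul₃, MinTensor.rep₃_tmul₃, trivial_unit, map_one, map_one,
      map_one (StarAlgHom.id ℂ A), map_one π]
  ext ξ
  refine mapL_one_create_injective hx ?_
  rw [← rep₃_comul, ← rep₃_comul, key]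

end Rep

/-- The regular representation in the last two legs separates the two tensors, because `g` moves the
vacuum vector to an orthogonal one in the middle leg. -/
theorem tmul₃_unit_ne {Γ : Type} [Group Γ] {A : Type w} [CStarAlgebra A]
    [Nontrivial (MinTensor.{w} A (GroupCStar Γ))] {g : Γ} (hg : g ≠ 1) :
    MinTensor.tmul₃.{w} (1 : A) (unit g) (unit g) ≠ MinTensor.tmul₃.{w} (1 : A) 1 (unit g) := by
  intro heq
  -- The minimal norm is a supremum over pairs of representations; if `A` acted only on zero spaces,
  -- the unit of the non-zero algebra `A ⊗ C*(Γ)` would have norm `0`.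
  have : ∃ (H : Type w) (_ : NormedAddCommGroup H) (_ : InnerProductSpace ℂ H)
      (_ : CompleteSpace H) (_ : A →⋆ₐ[ℂ] (H →L[ℂ] H)) (x : H), x ≠ 0 := by
    by_contra! hno
    refine one_ne_zero (α := MinTensor.{w} A (GroupCStar Γ)) (norm_le_zero_iff.mp ?_)
    refine MinTensor.norm_le_of_forall_rep _ _ le_rfl fun H _ _ _ K _ _ _ π τ => ?_
    rw [norm_le_zero_iff, map_one]
    exact HilbertTensor.ext fun y v => by
      rw [hno H _ _ _ π y, HilbertTensor.zero_tmul, map_zero, map_zero]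
  obtain ⟨H, _, _, _, π, x, hx⟩ := this
  have h1 := congrArg (fun y => MinTensor.rep₃.{w} π regularRep.{w} regularRep.{w} y
    (HilbertTensor.tmul x (HilbertTensor.tmul vacuum vacuum))) heq
  simp only [MinTensor.rep₃_tmul₃, map_one, HilbertTensor.mapL_tmul, regularRep_unit,
    one_apply_eq_self] at h1
  -- Against this vector the tensor with `g` in the middle leg gives `0`, and the one with `1` there
  -- gives `‖x‖²`.
  have h2 := congrArg (fun y => ⟪HilbertTensor.tmul x
    (HilbertTensor.tmul vacuum (leftRegular.{w} g vacuum)), y⟫_ℂ) h1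
  have h3 : ⟪leftRegular.{w} g vacuum, leftRegular.{w} g vacuum⟫_ℂ = 1 := by
    rw [HilbertTensor.inner_self_c]
    have : ‖leftRegular.{w} g vacuum‖ = 1 :=
      ((lpReindex (leftTranslation.{w} g)).norm_map vacuum).trans norm_vacuum
    rw [this]
    simp
  simp only [HilbertTensor.inner_tmul, inner_vacuum_leftRegular hg, h3,
    HilbertTensor.inner_self_c x, HilbertTensor.inner_self_c vacuum, norm_vacuum, zero_mul,
    mul_zero] at h2
  exact hx (by simpa using h2.symm)

end GroupCStar

/-- No non-zero multiple of `1 ⊗ g` with `g ≠ 1` is in the image of a coaction of `C*(Γ)`. -/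
theorem Coaction.hom_ne_smul_inr {Γ : Type} [Group Γ] {A : Type w} [CStarAlgebra A] [Nontrivial A]
    (δ : Coaction (GroupCStar.quantumGroup.{w} Γ) A) {g : Γ} (hg : g ≠ 1) {c : ℂ} (hc : c ≠ 0)
    (a : A) : δ.hom a ≠ c • MinTensor.inr.{w} (GroupCStar.unit g) := by
  intro h
  have : Nontrivial (MinTensor.{w} A (GroupCStar Γ)) := δ.injective.nontrivial
  have h1 := δ.coassoc a
  rw [h, map_smul, map_smul, map_smul, map_smul] at h1
  have h2 := smul_right_injective _ hc h1
  change MinTensor.assocL.{w} _ _ _ (MinTensor.map.{w} δ.hom _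
      (MinTensor.tmul.{w} 1 (GroupCStar.unit g))) =
    MinTensor.assocR.{w} _ _ _ (MinTensor.map.{w} (StarAlgHom.id ℂ A) GroupCStar.comul.{w}
      (MinTensor.tmul.{w} 1 (GroupCStar.unit g))) at h2
  -- Applying `δ` to the first leg of `1 ⊗ g` yields `1 ⊗ 1 ⊗ g`, while `Δ` on the second leg yields
  -- `1 ⊗ g ⊗ g`.
  rw [MinTensor.map_tmul, MinTensor.map_tmul, GroupCStar.comul_unit, map_one,
    MinTensor.assocR_tmul] at h2
  exact GroupCStar.tmul₃_unit_ne hg (h2.symm.trans (MinTensor.assocL_tmul 1 1 _))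

/-! ### Torsion-freeness and non-commutativity of the semidirect product -/

section Torsion

variable {n : ℕ} {σ : Matrix.SpecialLinearGroup (Fin n) ℤ}

/-- The embedding of `ℤⁿ` into `ℤⁿ ⋊ ℤ`. -/
abbrev HyperbolicGroup.lattice (σ : Matrix.SpecialLinearGroup (Fin n) ℤ) :
    Multiplicative (Fin n → ℤ) →* HyperbolicGroup σ := SemidirectProduct.inl

/-- The generator of the subgroup `ℤ` of `ℤⁿ ⋊ ℤ`. -/
def HyperbolicGroup.gen (σ : Matrix.SpecialLinearGroup (Fin n) ℤ) : HyperbolicGroup σ :=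
  SemidirectProduct.inr (.ofAdd 1)

/-- This relation is what makes every representation of the group conjugate its restriction to `ℤⁿ`
into its composition with the dual automorphism. -/
theorem HyperbolicGroup.gen_mul_lattice (m : Multiplicative (Fin n → ℤ)) :
    gen σ * lattice σ m * (gen σ)⁻¹ = lattice σ (dualAut σ m) := by
  rw [gen, lattice, ← map_inv, ← SemidirectProduct.inl_aut]
  simp

/-- A torsion element has torsion image in the quotient `ℤ`, hence lies in `ℤⁿ`, and both groups are
torsion-free. -/
theorem HyperbolicGroup.isTorsionFreeGroup : IsTorsionFreeGroup (HyperbolicGroup σ) := by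
  intro g hg hfin
  apply hg
  have h1 : g.right = 1 := by
    have := (SemidirectProduct.rightHom : HyperbolicGroup σ →* _).isOfFinOrder hfin
    exact (isOfFinOrder_iff_eq_one _).mp this
  have h2 : g = lattice σ g.left := by
    ext <;> simp [h1]
  rw [h2] at hfin ⊢
  rw [(isOfFinOrder_iff_eq_one _).mp ((Function.Injective.isOfFinOrder_iff (f := lattice σ)
    SemidirectProduct.inl_injective).mp hfin), map_one]

/-- A trivial dual action would mean `σ = 1`, which has the forbidden eigenvalue `1`; `hn` supplies
a coordinate carrying an eigenvector. -/
theorem IsHyperbolic.exists_dualAut_ne (hn : 2 ≤ n) (hσ : IsHyperbolic σ) :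
    ∃ m, dualAut σ m ≠ m := by
  by_contra! h
  have h1 : (σ : Matrix (Fin n) (Fin n) ℤ).transpose = 1 := by
    refine Matrix.ext_of_mulVec_single fun i => ?_
    rw [Matrix.one_mulVec]
    exact congrArg Multiplicative.toAdd (h (.ofAdd (Pi.single i 1)))
  have h2 : (σ : Matrix (Fin n) (Fin n) ℤ).map (Int.cast : ℤ → ℂ) = 1 := by
    rw [Matrix.transpose_eq_one.mp h1]
    simp
  refine hσ 1 ?_ norm_one
  rw [h2, Matrix.toLin'_one]
  refine Module.End.hasEigenvalue_of_hasEigenvector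
    (x := (Pi.single ⟨0, by omega⟩ 1 : Fin n → ℂ)) ⟨?_, ?_⟩
  · rw [Module.End.mem_eigenspace_iff, one_smul]
    rfl
  · simp

theorem HyperbolicGroup.isNonabelianGroup (hn : 2 ≤ n) (hσ : IsHyperbolic σ) :
    IsNonabelianGroup (HyperbolicGroup σ) := by
  obtain ⟨m, hm⟩ := hσ.exists_dualAut_ne hn
  refine ⟨gen σ, lattice σ m, fun h => hm ?_⟩
  have := gen_mul_lattice (σ := σ) m
  rw [h, mul_inv_cancel_right] at this
  exact (SemidirectProduct.inl_injective this).symm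

end Torsion

/-! ### Paths of representations and the Type 2 property -/

section TypeTwo

theorem MonoidHom.mem_unitary_of_inv {Γ D : Type*} [Group Γ] [Monoid D] [StarMul D]
    (u : Γ →* D) (hu : ∀ g, u g⁻¹ = star (u g)) (g : Γ) : u g ∈ unitary D := by
  rw [Unitary.mem_iff, ← hu, ← map_mul, ← map_mul]
  simp

/-- A unitary representation, with values in the unitary group. -/
def unitaryRep {Γ D : Type*} [Group Γ] [Monoid D] [StarMul D]
    (u : Γ →* D) (hu : ∀ g, u g⁻¹ = star (u g)) : Γ →* unitary D :=
  u.codRestrict (unitary D) (u.mem_unitary_of_inv hu)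

/-- A norm-continuous path of unitary representations of `ℤⁿ ⋊ ℤ` starting at a scalar
representation is constant on `ℤⁿ`. -/
theorem IsHyperbolic.path_constant {n : ℕ} {σ : Matrix.SpecialLinearGroup (Fin n) ℤ}
    (hσ : IsHyperbolic σ) {D : Type*} [CStarAlgebra D] [Nontrivial D]
    (u : unitInterval → HyperbolicGroup σ →* D) (hu : ∀ t g, u t g⁻¹ = star (u t g))
    (hc : ∀ g, Continuous fun t => u t g) (c : HyperbolicGroup σ → ℂ)
    (h0 : ∀ g, u 0 g = algebraMap ℂ D (c g)) (t : unitInterval) (i : Fin n) :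
    u t (HyperbolicGroup.lattice σ (.ofAdd (Pi.single i 1))) =
      algebraMap ℂ D (c (HyperbolicGroup.lattice σ (.ofAdd (Pi.single i 1)))) ∧
      c (HyperbolicGroup.lattice σ (.ofAdd (Pi.single i 1))) ≠ 0 := by
  have hinj : Function.Injective (algebraMap ℂ D) := (algebraMap ℂ D).injective
  have hcstar : ∀ g, c g⁻¹ = star (c g) := fun g => hinj <| by
    rw [← h0, hu, h0, algebraMap_star_comm]
  have hcmul : ∀ g k, c (g * k) = c g * c k := fun g k => hinj <| by
    rw [map_mul, ← h0, ← h0, ← h0, map_mul]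
  have hc1 : c 1 = 1 := hinj <| by rw [← h0, map_one, map_one]
  have hcinv : ∀ g, c g⁻¹ * c g = 1 := fun g => by rw [← hcmul, inv_mul_cancel, hc1]
  -- Twisting by the inverse of the character `c` moves the start of the path to the trivial
  -- representation, where rigidity applies.
  let x : unitInterval → HyperbolicGroup σ →* D := fun t =>
    { toFun := fun g => c g⁻¹ • u t g
      map_one' := by simp [hc1]
      map_mul' := fun g k => by
        rw [smul_mul_smul_comm, map_mul, mul_inv_rev, hcmul, mul_comm (c k⁻¹)] }
  have hx : ∀ t g, x t g = c g⁻¹ • u t g := fun _ _ => rfl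
  have hxstar : ∀ t g, x t g⁻¹ = star (x t g) := fun t g => by
    rw [hx, hx, star_smul, hu, ← hcstar]
  let v : unitInterval → Multiplicative (Fin n → ℤ) →* unitary D := fun t =>
    (unitaryRep (x t) (hxstar t)).comp (HyperbolicGroup.lattice σ)
  have hv : ∀ t m, (v t m : D) = x t (HyperbolicGroup.lattice σ m) := fun _ _ => rfl
  have hvc : ∀ m, Continuous fun t => (v t m : D) := fun m => by
    simp only [hv, hx]
    exact (hc _).const_smul _
  obtain ⟨ε, hε, hrig⟩ := hσ.rigid D
  let S : Set unitInterval := {t | ∀ i, (v t (.ofAdd (Pi.single i 1)) : D) = 1}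
  have hclosed : IsClosed S := by
    simp only [S, Set.ofPred_forall]
    exact isClosed_iInter fun i => isClosed_eq (hvc _) continuous_const
  -- Rigidity says that being within `ε` of `1` on the generators already forces equality, so the
  -- closed condition is also open. The same `ε` serves all `t`, and the conjugating unitary is the
  -- image of the generator of `ℤ`.
  have hopen : IsOpen S := by
    have : S = {t | ∀ i, ‖(v t (.ofAdd (Pi.single i 1)) : D) - 1‖ < ε} := by
      ext t
      refine ⟨fun ht i => by rw [ht i, sub_self, norm_zero]; exact hε, fun ht i => ?_⟩
      refine congrArg Subtype.val (hrig (v t) (unitaryRep (x t) (hxstar t)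
        (HyperbolicGroup.gen σ)) (fun m => ?_) ht i)
      change unitaryRep (x t) (hxstar t) _ * unitaryRep (x t) (hxstar t) _ * _ =
        unitaryRep (x t) (hxstar t) _
      rw [← map_inv, ← map_mul, ← map_mul, HyperbolicGroup.gen_mul_lattice]
    rw [this]
    simp only [Set.ofPred_forall]
    exact isOpen_iInter_of_finite fun i =>
      isOpen_lt ((hvc _).sub continuous_const).norm continuous_const
  have huniv : S = Set.univ := IsClopen.eq_univ ⟨hclosed, hopen⟩
    ⟨0, fun i => by
      rw [hv, hx, h0, Algebra.algebraMap_eq_smul_one, smul_smul, hcinv, one_smul]⟩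
  have ht : t ∈ S := huniv ▸ Set.mem_univ t
  have h1 := ht i
  rw [hv, hx] at h1
  have h2 := congrArg (c (HyperbolicGroup.lattice σ (.ofAdd (Pi.single i 1))) • ·) h1
  simp only [smul_smul] at h2
  rw [mul_comm, hcinv, one_smul, ← Algebra.algebraMap_eq_smul_one] at h2
  exact ⟨h2, right_ne_zero_of_mul_eq_one (hcinv _)⟩

theorem HyperbolicGroup.typeTwoHolds {n : ℕ} (hn : 2 ≤ n)
    {σ : Matrix.SpecialLinearGroup (Fin n) ℤ} (hσ : IsHyperbolic σ) :
    TypeTwoHolds.{w} (GroupCStar.quantumGroup.{w} (HyperbolicGroup σ)) := by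
  rintro A _ _ δ - ⟨ψ, hψ⟩
  have : Nontrivial (MinTensor.{w} A (GroupCStar (HyperbolicGroup σ))) := δ.injective.nontrivial
  let F : unitInterval → GroupCStar (HyperbolicGroup σ) →⋆ₐ[ℂ]
      MinTensor.{w} A (GroupCStar (HyperbolicGroup σ)) :=
    -- The sliced path is kept in `A ⊗ C*(Γ)`, with scalars in the second leg, so that `A ⊗ ℂ` need
    -- not be identified with `A`.
    fun t => GroupCStar.slice.comp ((δ.evalAt t).comp ψ)
  let u : unitInterval → HyperbolicGroup σ →* MinTensor.{w} A (GroupCStar (HyperbolicGroup σ)) :=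
    fun t => ((F t).toAlgHom : _ →* _).comp GroupCStar.unit
  have hu : ∀ t g, u t g = F t (GroupCStar.unit g) := fun _ _ => rfl
  have hF : ∀ t g, F t g = GroupCStar.slice ((ψ g).1 t) := fun _ _ => rfl
  have hstar : ∀ t g, u t g⁻¹ = star (u t g) := fun t g => by
    rw [hu, hu, GroupCStar.unit_inv, map_star]
  have hcont : ∀ g, Continuous fun t => u t g := fun g => by
    simp only [hu, hF]
    exact (continuous_starHom GroupCStar.slice).comp (ψ (GroupCStar.unit g)).1.continuous
  choose h hh using fun g => ((δ.mem_join _).mp (ψ (GroupCStar.unit g)).2).1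
  have h0 : ∀ g, u 0 g = algebraMap ℂ _ (GroupCStar.counit (h g)) := fun g => by
    rw [hu, hF, ← hh, GroupCStar.slice_inr]
  let i : Fin n := ⟨0, by omega⟩
  -- The scalar found at `t = 0` is carried to `t = 1`, the endpoint where the join meets the image
  -- of `δ`.
  obtain ⟨hconst, hc⟩ := hσ.path_constant u hstar hcont _ h0 1 i
  set e : HyperbolicGroup σ := HyperbolicGroup.lattice σ (.ofAdd (Pi.single i 1)) with he
  have he1 : e ≠ 1 := fun h => by
    have h1 : Multiplicative.ofAdd (Pi.single i 1 : Fin n → ℤ) = 1 :=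
      SemidirectProduct.inl_injective (h.trans (map_one _).symm)
    have h2 := congrFun (congrArg Multiplicative.toAdd h1) i
    simp at h2
  -- As `Δ(e) = e ⊗ e`, equivariance at `t = 1` says that `ψ(e)(1)` is homogeneous of degree `e`.
  have heq := hψ (GroupCStar.unit e) 1
  change _ = MinTensor.assocL.{w} _ _ _ (MinTensor.map.{w} _ _ (GroupCStar.comul _)) at heq
  rw [GroupCStar.comul_unit, MinTensor.map_tmul] at heq
  have h1 := GroupCStar.eq_smul_inr_of_slice heq hconst
  obtain ⟨a, ha⟩ := ((δ.mem_join _).mp (ψ (GroupCStar.unit e)).2).2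
  exact δ.hom_ne_smul_inr he1 hc a (ha.trans h1)

end TypeTwo

/-! ### Invariant means and amenability -/

section Amenable

/-- `M` is a left-invariant mean on the `[0,1]`-valued functions on the group `G`. -/
structure IsInvariantMean {G : Type*} [Group G] (M : (G → ℝ) → ℝ) : Prop where
  nonneg : ∀ F, (∀ x, F x ∈ Set.Icc (0 : ℝ) 1) → 0 ≤ M F
  le_one : ∀ F, (∀ x, F x ∈ Set.Icc (0 : ℝ) 1) → M F ≤ 1
  one : M (fun _ => 1) = 1
  add : ∀ F F', (∀ x, F x ∈ Set.Icc (0 : ℝ) 1) → (∀ x, F' x ∈ Set.Icc (0 : ℝ) 1) →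
    (∀ x, F x + F' x ∈ Set.Icc (0 : ℝ) 1) → M (fun x => F x + F' x) = M F + M F'
  inv : ∀ F, (∀ x, F x ∈ Set.Icc (0 : ℝ) 1) → ∀ g, M (fun x => F (g * x)) = M F

namespace IsInvariantMean

theorem isAmenableGroup {G : Type*} [Group G] {M : (G → ℝ) → ℝ} (hM : IsInvariantMean M) :
    IsAmenableGroup G := by
  have hmem : ∀ (S : Set G) (x : G), S.indicator 1 x ∈ Set.Icc (0 : ℝ) 1 := fun S x => by
    by_cases h : x ∈ S <;> simp [h]
  refine ⟨fun S => M (S.indicator 1), fun S => hM.nonneg _ (hmem S), ?_, fun S T hST => ?_,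
    fun g S => ?_⟩
  · simp only [Set.indicator_univ]
    exact hM.one
  · have h : (S ∪ T).indicator (1 : G → ℝ) = fun x => S.indicator 1 x + T.indicator 1 x :=
      Set.indicator_union_of_disjoint hST _
    have h1 := hmem (S ∪ T)
    change M _ = _
    rw [h] at h1 ⊢
    exact hM.add _ _ (hmem S) (hmem T) h1
  · change M _ = M _
    -- The indicator of `gS` at `x` is that of `S` at `g⁻¹ x`.
    rw [← hM.inv (S.indicator 1) (hmem S) g⁻¹]
    congr 1
    ext x
    by_cases h : g⁻¹ * x ∈ S <;> simp [h, Set.indicator]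

/-- Invariant means pass to extensions. -/
theorem extension {K Q G : Type*} [Group K] [Group Q] [Group G] {M : (K → ℝ) → ℝ}
    {M' : (Q → ℝ) → ℝ} (hM : IsInvariantMean M) (hM' : IsInvariantMean M') (s : Q → K → G)
    (p : G → Q) (hs : ∀ g q, ∃ k, ∀ k', g * s q k' = s (p g * q) (k * k')) :
    IsInvariantMean (fun F : G → ℝ => M' fun q => M fun k => F (s q k)) where
  nonneg F hF := hM'.nonneg _ fun q =>
    ⟨hM.nonneg _ fun k => hF _, hM.le_one _ fun k => hF _⟩
  le_one F hF := hM'.le_one _ fun q =>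
    ⟨hM.nonneg _ fun k => hF _, hM.le_one _ fun k => hF _⟩
  one := by simp only [hM.one, hM'.one]
  add F F' hF hF' hFF' := by
    have h : ∀ q, M (fun k => F (s q k) + F' (s q k)) =
        M (fun k => F (s q k)) + M fun k => F' (s q k) := fun q =>
      hM.add _ _ (fun _ => hF _) (fun _ => hF' _) fun _ => hFF' _
    simp only [h]
    refine hM'.add _ _ (fun q => ⟨hM.nonneg _ fun k => hF _, hM.le_one _ fun k => hF _⟩)
      (fun q => ⟨hM.nonneg _ fun k => hF' _, hM.le_one _ fun k => hF' _⟩) fun q => ?_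
    rw [← h]
    exact ⟨hM.nonneg _ fun k => hFF' _, hM.le_one _ fun k => hFF' _⟩
  inv F hF g := by
    -- Left multiplication by `g` carries the fibre over `q` to the fibre over `p g * q`, up to a
    -- left translation in `K` that `M` ignores. What remains is a translation in `Q`, ignored by
    -- `M'`.
    have h : ∀ q, M (fun k => F (g * s q k)) = M fun k => F (s (p g * q) k) := fun q => by
      obtain ⟨k, hk⟩ := hs g q
      simp only [hk]
      exact hM.inv (fun k => F (s (p g * q) k)) (fun _ => hF _) k
    simp only [h]
    exact hM'.inv (fun q => M fun k => F (s q k))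
      (fun q => ⟨hM.nonneg _ fun k => hF _, hM.le_one _ fun k => hF _⟩) (p g)

theorem eval_one (G : Type*) [Group G] [Subsingleton G] :
    IsInvariantMean (fun F : G → ℝ => F 1) where
  nonneg _ hF := (hF 1).1
  le_one _ hF := (hF 1).2
  one := rfl
  add _ _ _ _ _ := rfl
  inv F _ _ := congrArg F (Subsingleton.elim _ _)

open Filter Topology

/-- The average of a function over `{0, …, N}`. -/
def average (N : ℕ) (F : Multiplicative ℤ → ℝ) : ℝ :=
  (∑ i ∈ Finset.range (N + 1), F (.ofAdd (i : ℤ))) / (N + 1)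

theorem average_mem {F : Multiplicative ℤ → ℝ} (hF : ∀ x, F x ∈ Set.Icc (0 : ℝ) 1) (N : ℕ) :
    average N F ∈ Set.Icc (0 : ℝ) 1 := by
  refine ⟨div_nonneg (Finset.sum_nonneg fun i _ => (hF _).1) (by positivity), ?_⟩
  refine div_le_one_of_le₀ ?_ (by positivity)
  refine (Finset.sum_le_card_nsmul _ _ 1 fun i _ => (hF _).2).trans_eq ?_
  simp

/-- Shifting the window `{0, …, N}` by one gains the term at `N + 1` and loses the term at `0`. -/
theorem average_shift (N : ℕ) (F : Multiplicative ℤ → ℝ) :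
    average N (fun x => F (.ofAdd 1 * x)) =
      average N F + (F (.ofAdd ((N + 1 : ℕ) : ℤ)) - F 1) / (N + 1) := by
  have h1 := Finset.sum_range_succ (fun i : ℕ => F (.ofAdd (i : ℤ))) (N + 1)
  rw [Finset.sum_range_succ'] at h1
  have h2 : ∀ i : ℕ, F (.ofAdd 1 * .ofAdd (i : ℤ)) = F (.ofAdd ((i + 1 : ℕ) : ℤ)) := fun i => by
    rw [← ofAdd_add, add_comm, Nat.cast_succ]
  rw [average, average, ← add_div]
  simp only [h2]
  congr 1
  have h3 : F (.ofAdd ((0 : ℕ) : ℤ)) = F 1 := rfl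
  linarith

/-- An ultralimit of averages on `ℤ`. -/
def intMean (F : Multiplicative ℤ → ℝ) : ℝ :=
  limUnder (hyperfilter ℕ : Filter ℕ) fun N => average N F

/-- The averages stay in the compact interval `[0,1]`, so they converge along any ultrafilter. This
is what gives the `limUnder` in `intMean` its meaning for `[0,1]`-valued functions. -/
theorem tendsto_intMean {F : Multiplicative ℤ → ℝ} (hF : ∀ x, F x ∈ Set.Icc (0 : ℝ) 1) :
    Tendsto (fun N => average N F) (hyperfilter ℕ : Filter ℕ) (𝓝 (intMean F)) := by
  refine tendsto_nhds_limUnder ?_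
  obtain ⟨x, -, hx⟩ := isCompact_Icc.ultrafilter_le_nhds
    ((hyperfilter ℕ).map fun N => average N F)
    (le_principal_iff.mpr (Filter.mem_map.mpr (Eventually.of_forall (average_mem hF))))
  exact ⟨x, hx⟩

theorem tendsto_average_shift_sub {F : Multiplicative ℤ → ℝ}
    (hF : ∀ x, F x ∈ Set.Icc (0 : ℝ) 1) :
    Tendsto (fun N : ℕ => (F (.ofAdd ((N + 1 : ℕ) : ℤ)) - F 1) / ((N : ℝ) + 1)) atTop (𝓝 0) := by
  refine squeeze_zero_norm (a := fun N : ℕ => 1 / ((N : ℝ) + 1)) (fun N => ?_)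
    tendsto_one_div_add_atTop_nhds_zero_nat
  rw [norm_div, Real.norm_of_nonneg (by positivity : (0 : ℝ) ≤ N + 1)]
  have h1 := hF (.ofAdd ((N + 1 : ℕ) : ℤ))
  have h2 := hF 1
  refine div_le_div_of_nonneg_right ?_ (by positivity)
  rw [Real.norm_eq_abs, abs_le]
  constructor <;> linarith [h1.1, h1.2, h2.1, h2.2]

/-- The shift error is at most `1 / (N + 1)`, and it vanishes in the limit because the hyperfilter
refines `atTop`. -/
theorem intMean_shift {F : Multiplicative ℤ → ℝ} (hF : ∀ x, F x ∈ Set.Icc (0 : ℝ) 1) :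
    intMean (fun x => F (.ofAdd 1 * x)) = intMean F := by
  have h1 := tendsto_intMean (F := fun x => F (.ofAdd 1 * x)) fun x => hF (.ofAdd 1 * x)
  have h2 := (tendsto_intMean hF).add
    ((tendsto_average_shift_sub hF).mono_left Nat.hyperfilter_le_atTop)
  rw [add_zero] at h2
  refine tendsto_nhds_unique (h1.congr fun N => ?_) h2
  exact average_shift N F

theorem int : IsInvariantMean intMean where
  nonneg F hF := ge_of_tendsto' (tendsto_intMean hF) fun N => (average_mem hF N).1
  le_one F hF := le_of_tendsto' (tendsto_intMean hF) fun N => (average_mem hF N).2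
  one := by
    refine tendsto_nhds_unique (tendsto_intMean fun _ => by simp) ?_
    have : ∀ N, average N (fun _ => 1) = 1 := fun N => by
      rw [average, Finset.sum_const, Finset.card_range, nsmul_one, Nat.cast_succ,
        div_self (by positivity)]
    simp only [this]
    exact tendsto_const_nhds
  add F F' hF hF' hFF' := by
    refine tendsto_nhds_unique (tendsto_intMean hFF') ?_
    have : ∀ N, average N (fun x => F x + F' x) = average N F + average N F' := fun N => by
      rw [average, Finset.sum_add_distrib, add_div]; rfl
    simp only [this]
    exact (tendsto_intMean hF).add (tendsto_intMean hF')
  inv F hF g := by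
    obtain ⟨k, rfl⟩ := Multiplicative.ofAdd.surjective g
    induction k using Int.induction_on with
    | zero => simp
    | succ k ih =>
      rw [← ih, ← intMean_shift (F := fun x => F (.ofAdd (k : ℤ) * x)) fun _ => hF _]
      simp only [ofAdd_add, mul_assoc]
    | pred k ih =>
      -- The unit shift is applied to the translate by `-k - 1`, which it turns into the translate
      -- by `-k` of the induction hypothesis.
      rw [← ih, ← intMean_shift (F := fun x => F (.ofAdd (-(k : ℤ) - 1) * x)) fun _ => hF _]
      simp only [← mul_assoc, ← ofAdd_add, sub_add_cancel]

theorem exists_lattice (n : ℕ) :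
    ∃ M : (Multiplicative (Fin n → ℤ) → ℝ) → ℝ, IsInvariantMean M := by
  induction n with
  | zero =>
    have : Subsingleton (Multiplicative (Fin 0 → ℤ)) :=
      inferInstanceAs (Subsingleton (Fin 0 → ℤ))
    exact ⟨_, eval_one _⟩
  | succ n ih =>
    obtain ⟨M, hM⟩ := ih
    -- `ℤⁿ⁺¹` is fibred over its first coordinate, with the remaining coordinates as kernel.
    refine ⟨_, hM.extension int (fun q k => .ofAdd (Fin.cons q.toAdd k.toAdd))
      (fun g => .ofAdd (g.toAdd 0)) fun g q => ⟨.ofAdd (Fin.tail g.toAdd), fun k => ?_⟩⟩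
    refine congrArg Multiplicative.ofAdd (funext fun i => ?_)
    refine Fin.cases ?_ (fun i => ?_) i <;> rfl

end IsInvariantMean

/-- Writing elements with the quotient part on the left makes left multiplication act on each fibre
by a left translation of `N`, the form that `IsInvariantMean.extension` requires. -/
theorem SemidirectProduct.mul_inr_mul_inl {N G : Type*} [Group N] [Group G] {φ : G →* MulAut N}
    (g : N ⋊[φ] G) (q : G) (k : N) :
    g * (inr q * inl k) = inr (g.right * q) * inl (φ (g.right * q)⁻¹ g.left * k) := by
  ext1 <;> simp [mul_assoc]

theorem HyperbolicGroup.isAmenableGroup {n : ℕ} (σ : Matrix.SpecialLinearGroup (Fin n) ℤ) :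
    IsAmenableGroup (HyperbolicGroup σ) := by
  obtain ⟨M, hM⟩ := IsInvariantMean.exists_lattice n
  refine (hM.extension IsInvariantMean.int
    (fun q k => (SemidirectProduct.inr q * SemidirectProduct.inl k : HyperbolicGroup σ))
    (fun g => g.right) fun g q => ?_).isAmenableGroup
  exact ⟨_, SemidirectProduct.mul_inr_mul_inl g q⟩

end Amenable

/-! ### Arnold's cat map as a hyperbolic example -/

section CatMap

/-- The matrix of Arnold's cat map. -/
def catMap : Matrix.SpecialLinearGroup (Fin 2) ℤ := ⟨!![2, 1; 1, 1], by simp [Matrix.det_fin_two]⟩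

theorem isHyperbolic_catMap : IsHyperbolic catMap := by
  intro μ hμ h1
  obtain ⟨v, hv⟩ := hμ.exists_hasEigenvector
  have e := hv.apply_eq_smul
  rw [Matrix.toLin'_apply] at e
  have e0 : 2 * v 0 + v 1 = μ * v 0 := by
    simpa [catMap, Matrix.mulVec, dotProduct, Fin.sum_univ_two] using congrFun e 0
  have e1 : v 0 + v 1 = μ * v 1 := by
    simpa [catMap, Matrix.mulVec, dotProduct, Fin.sum_univ_two] using congrFun e 1
  have hroot : μ ^ 2 - 3 * μ + 1 = 0 := by
    have hv1 : v 1 ≠ 0 := fun h => hv.2 <| by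
      have h0 : v 0 = 0 := by simpa [h] using e1
      ext i
      fin_cases i
      · exact h0
      · exact h
    refine mul_right_cancel₀ hv1 ?_
    -- Eliminating `v 0` from the two eigenvector equations leaves the characteristic polynomial
    -- times `v 1`.
    linear_combination (2 - μ) * e1 - e0
  have hs : Complex.normSq μ = 1 := by rw [Complex.normSq_eq_norm_sq, h1, one_pow]
  have hre := Complex.abs_re_le_norm μ
  rw [h1, abs_le] at hre
  -- On the unit circle the conjugate of `μ` is its inverse, so the characteristic equation divided
  -- by `μ` gives twice the real part of `μ` equal to `3`, contradicting the bound `1` on that real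
  -- part.
  have h2 : μ + (starRingEnd ℂ) μ = 3 := by
    have hc : μ * (starRingEnd ℂ) μ = 1 := by rw [Complex.mul_conj, hs, Complex.ofReal_one]
    linear_combination (starRingEnd ℂ) μ * hroot - (μ - 3) * hc
  have h3 := congrArg Complex.re h2
  simp at h3
  linarith [hre.2]

end CatMap

end

theorem mainTheorem4 :
    (∀ (n : ℕ) (_ : 2 ≤ n) (σ : Matrix.SpecialLinearGroup (Fin n) ℤ), IsHyperbolic σ →
      IsTorsionFreeGroup (HyperbolicGroup σ) ∧
      IsNonabelianGroup (HyperbolicGroup σ) ∧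
      IsAmenableGroup (HyperbolicGroup σ) ∧
      TypeTwoHolds.{w} (GroupCStar.quantumGroup.{w} (HyperbolicGroup σ))) ∧
    (∃ (Γ : Type) (_ : Group Γ),
      IsTorsionFreeGroup Γ ∧ IsNonabelianGroup Γ ∧ IsAmenableGroup Γ ∧
      TypeTwoHolds.{w} (GroupCStar.quantumGroup.{w} Γ)) :=
  have h : ∀ (n : ℕ) (_ : 2 ≤ n) (σ : Matrix.SpecialLinearGroup (Fin n) ℤ), IsHyperbolic σ →
      IsTorsionFreeGroup (HyperbolicGroup σ) ∧
      IsNonabelianGroup (HyperbolicGroup σ) ∧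
      IsAmenableGroup (HyperbolicGroup σ) ∧
      TypeTwoHolds.{w} (GroupCStar.quantumGroup.{w} (HyperbolicGroup σ)) := fun _ hn σ hσ =>
    ⟨HyperbolicGroup.isTorsionFreeGroup, HyperbolicGroup.isNonabelianGroup hn hσ,
      HyperbolicGroup.isAmenableGroup σ, HyperbolicGroup.typeTwoHolds hn hσ⟩
  ⟨h, HyperbolicGroup catMap, inferInstance, h 2 le_rfl catMap isHyperbolic_catMap⟩
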